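/- Let $n\ge 1$. A contingency matrix of size $p\times q$ and weight $n$ is a $p\times q$ matrix of non-negative integers whose entries sum to $n$ and in which every row and every column contains a non-zero entry. Let $\mathrm{CM}_n$ be the set of all contingency matrices of weight $n$ (of all sizes), partially ordered by $M\le N$ if $N$ can be obtained from $M$ by a finite (possibly empty) sequence of contractions, a contraction being the replacement of two adjacent rows, or of two adjacent columns, by their sum. For a poset $T$ let $\mathrm N(T)$ be the geometric realization of the nerve of $T$ (the simplicial set whose $r$-simplices are the chains $t_0\le\dots\le t_r$). Put $\mathcal{S}t_n=\mathrm N(\mathrm{CM}_n)$ (the $n$-th stochastihedron), and for $M\in\mathrm{CM}_n$ put $F(M)=\mathrm N(\{M'\in \mathrm{CM}_n: M'\le M\})$ and $F'(M)=\mathrm N(\{M'\in\mathrm{CM}_n: M'<M\})$. A cell decomposition of a topological space $X$ is a filtration $X_0\subset X_1\subset\cdots$ of $X=\bigcup_m X_m$ by closed subspaces such that each $X_m\setminus X_{m-1}$ (with $X_{-1}=\emptyset$) is a topological disjoint union of $m$-cells, i.e. of spaces homeomorphic to the open unit ball of $\mathbb R^m$; the cells are the connected components of the $X_m\setminus X_{m-1}$.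 It is regular if, for each $m$-cell $\sigma$, there is a homeomorphism from $\overline\sigma$ to the closed unit ball of $\mathbb R^m$ that maps $\sigma$ onto the open ball, and the boundary $\overline\sigma\setminus\sigma$ is a union of cells. Then, for every contingency matrix $M$ of size $p\times q$ and weight $n$, the space $F(M)$ is homeomorphic to the closed ball of dimension $2n-(p+q)$, and $F'(M)$ is homeomorphic to the sphere $S^{2n-(p+q)-1}$ (where $S^{-1}=\emptyset$). The natural maps $F(M)\to \mathcal{S}t_n$ and $F'(M)\to\mathcal{S}t_n$ are closed embeddings; identify $F(M)$ and $F'(M)$ with their images, and put $F^\circ(M)=F(M)\setminus F'(M)$. Then $\mathcal{S}t_n$ has a regular cell decomposition whose cells are exactly the sets $F^\circ(M)$, $M\in\mathrm{CM}_n$; the cell $F^\circ(M)$ has dimension $2n-(p+q)$ and closure $F(M)$, and $M\mapsto F^\circ(M)$ is an isomorphism from the poset $\mathrm{CM}_n$ onto the set of cells ordered by inclusion of their closures. -/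

import Mathlib

open CategoryTheory

/-! ### Contingency matrices -/

/-- `ContMat n p q`: the `p × q` matrices of non-negative integers, of weight `n`, such that each
row and each column contains a non-zero entry. -/
@[ext]
structure ContMat (n p q : ℕ) where
  entry : Matrix (Fin p) (Fin q) ℕ
  row_ne : ∀ i, ∃ j, entry i j ≠ 0
  col_ne : ∀ j, ∃ i, entry i j ≠ 0
  weight : ∑ i, ∑ j, entry i j = n

namespace ContMat

variable {n p q : ℕ}

/-- The transposed matrix. -/
def transpose (M : ContMat n p q) : ContMat n q p where
  entry := M.entry.transpose
  row_ne := M.col_ne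
  col_ne := M.row_ne
  weight := by
    refine Eq.trans ?_ M.weight
    exact Finset.sum_comm

/-- Add up the adjacent rows with indices `i` and `i + 1` (counted from `0`). The map
`i.predAbove : Fin (p + 1) → Fin p` is the monotone surjection that takes the value `i` at both
`i` and `i + 1` and is injective otherwise. -/
def contractRow (M : ContMat n (p + 1) q) (i : Fin p) : ContMat n p q where
  entry := Matrix.of fun k j => ∑ r : Fin (p + 1) with i.predAbove r = k, M.entry r j
  row_ne := by
    intro k
    obtain ⟨r, hr⟩ := Fin.predAbove_surjective i k
    obtain ⟨j, hj⟩ := M.row_ne r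
    refine ⟨j, fun h => hj ?_⟩
    rw [Matrix.of_apply] at h
    exact (Finset.sum_eq_zero_iff.1 h) r (by simp [hr])
  col_ne := by
    intro j
    obtain ⟨r, hr⟩ := M.col_ne j
    refine ⟨i.predAbove r, fun h => hr ?_⟩
    rw [Matrix.of_apply] at h
    exact (Finset.sum_eq_zero_iff.1 h) r (by simp)
  weight := by
    simp only [Matrix.of_apply]
    refine Eq.trans ?_ M.weight
    refine Eq.trans ?_ (Finset.sum_fiberwise Finset.univ i.predAbove fun r => ∑ j, M.entry r j)
    exact Finset.sum_congr rfl fun k _ => Finset.sum_comm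

/-- Add up the adjacent columns with indices `j` and `j + 1` (counted from `0`). -/
def contractCol (M : ContMat n p (q + 1)) (j : Fin q) : ContMat n p q :=
  (M.transpose.contractRow j).transpose

theorem rows_le (M : ContMat n p q) : p ≤ n := by
  have h : ∑ _i : Fin p, 1 ≤ ∑ i, ∑ j, M.entry i j := by
    refine Finset.sum_le_sum fun i _ => ?_
    obtain ⟨j, hj⟩ := M.row_ne i
    exact (Nat.one_le_iff_ne_zero.2 hj).trans
      (Finset.single_le_sum (f := fun j => M.entry i j) (fun _ _ => Nat.zero_le _)
        (Finset.mem_univ j))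
  rw [M.weight] at h
  simpa using h

/-- The difference `2 * n - (p + q)` of natural numbers is never truncated. -/
theorem size_le (M : ContMat n p q) : p + q ≤ 2 * n := by
  have h₁ := M.rows_le
  have h₂ := M.transpose.rows_le
  omega

end ContMat

/-- `CM n`: the set of all contingency matrices of weight `n`, of all sizes. -/
structure CM (n : ℕ) where
  rows : ℕ
  cols : ℕ
  mat : ContMat n rows cols

namespace CM

variable {n : ℕ}

/-- `Step M N`: `N` is obtained from `M` by a single contraction, of rows or of columns. -/
inductive Step : CM n → CM n → Prop
  | row {p q : ℕ} (M : ContMat n (p + 1) q) (i : Fin p) :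
      Step ⟨p + 1, q, M⟩ ⟨p, q, M.contractRow i⟩
  | col {p q : ℕ} (M : ContMat n p (q + 1)) (j : Fin q) :
      Step ⟨p, q + 1, M⟩ ⟨p, q, M.contractCol j⟩

theorem Step.size_lt {M N : CM n} (h : Step M N) : N.rows + N.cols < M.rows + M.cols := by
  cases h <;> simp only <;> omega

theorem size_lt_or_eq {M N : CM n} (h : Relation.ReflTransGen Step M N) :
    N.rows + N.cols < M.rows + M.cols ∨ M = N := by
  induction h with
  | refl => exact Or.inr rfl
  | tail _ hs ih =>
    have := hs.size_lt
    rcases ih with ih | rfl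
    · exact Or.inl (by omega)
    · exact Or.inl this

/-- `M ≤ N` if `N` can be obtained from `M` by a series of contractions. -/
instance : PartialOrder (CM n) where
  le := Relation.ReflTransGen Step
  le_refl _ := Relation.ReflTransGen.refl
  le_trans _ _ _ := Relation.ReflTransGen.trans
  le_antisymm M N h₁ h₂ := by
    rcases size_lt_or_eq h₁ with h | h
    · rcases size_lt_or_eq h₂ with h' | h'
      · omega
      · exact h'.symm
    · exact h

end CM

/-! ### Nerves of posets -/

/-- `N(T)`: the geometric realization of the simplicial set `nerve T` of a poset `T`. -/
noncomputable abbrev PosetNerve (T : Type) [PartialOrder T] : Type :=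
  (SSet.toTop.obj (nerve T) : TopCat)

/-- The continuous map `N(A) → N(T)` induced by the inclusion of a subset `A` of a poset `T`. -/
noncomputable def PosetNerve.incl {T : Type} [PartialOrder T] (A : Set T) :
    PosetNerve A → PosetNerve T :=
  SSet.toTop.map (nerveMap (Subtype.mono_coe (· ∈ A)).functor)

/-! ### Cell decompositions -/

/-- An `m`-cell: a space homeomorphic to the open unit ball of `ℝᵐ`. -/
def IsOpenCell (m : ℕ) (Y : Type) [TopologicalSpace Y] : Prop :=
  Nonempty (Y ≃ₜ Metric.ball (0 : EuclideanSpace ℝ (Fin m)) 1)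

/-- A closed `m`-cell: a space homeomorphic to the closed unit ball of `ℝᵐ`. -/
def IsClosedCell (m : ℕ) (Y : Type) [TopologicalSpace Y] : Prop :=
  Nonempty (Y ≃ₜ Metric.closedBall (0 : EuclideanSpace ℝ (Fin m)) 1)

/-- The part `X_m ∖ X_{m-1}` of a filtration `X_0 ⊆ X_1 ⊆ ⋯`, where `X_{-1} = ∅`. -/
def stratum {X : Type} (skel : ℕ → Set X) : ℕ → Set X
  | 0 => skel 0
  | m + 1 => skel (m + 1) \ skel m

/-- A cell decomposition: a filtration `X_0 ⊆ X_1 ⊆ ⋯` of `X = ⋃ X_m` by closed subspaces such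
that each `X_m ∖ X_{m-1}` is a disjoint union of `m`-cells, i.e. its connected components are
open in it and are `m`-cells. -/
structure CellDecomposition (X : Type) [TopologicalSpace X] where
  skel : ℕ → Set X
  isClosed_skel : ∀ m, IsClosed (skel m)
  monotone_skel : Monotone skel
  iUnion_skel : ⋃ m, skel m = Set.univ
  isOpen_component : ∀ m, ∀ x ∈ stratum skel m,
    ∃ U, IsOpen U ∧ connectedComponentIn (stratum skel m) x = stratum skel m ∩ U
  isOpenCell_component : ∀ m, ∀ x ∈ stratum skel m,
    IsOpenCell m (connectedComponentIn (stratum skel m) x)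

namespace CellDecomposition

variable {X : Type} [TopologicalSpace X]

/-- The `m`-dimensional cells: the connected components of `X_m ∖ X_{m-1}`. -/
def cells (D : CellDecomposition X) (m : ℕ) : Set (Set X) :=
  {σ | ∃ x ∈ stratum D.skel m, σ = connectedComponentIn (stratum D.skel m) x}

/-- The set of all cells, of all dimensions. -/
def Cell (D : CellDecomposition X) : Type :=
  {σ : Set X // ∃ m, σ ∈ D.cells m}

/-- Cells are ordered by inclusion of their closures. -/
instance (D : CellDecomposition X) : Preorder D.Cell :=
  Preorder.lift fun σ => closure σ.1

/-- A cell decomposition is regular if the closure of each `m`-cell `σ` is a closed `m`-cell, with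
`σ` corresponding to the open ball, and the boundary of `σ` is a union of cells. -/
def IsRegular (D : CellDecomposition X) : Prop :=
  ∀ m, ∀ σ ∈ D.cells m,
    (∃ h : closure σ ≃ₜ Metric.closedBall (0 : EuclideanSpace ℝ (Fin m)) 1,
      ∀ x : closure σ, (x : X) ∈ σ ↔ (h x : EuclideanSpace ℝ (Fin m)) ∈ Metric.ball 0 1) ∧
    ∃ S : Set D.Cell, closure σ \ σ = ⋃ τ ∈ S, τ.1

end CellDecomposition

/-! ### The stochastihedron -/

/-- The `n`-th stochastihedron `St_n = N(CM_n)`. -/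
noncomputable abbrev Stochastihedron (n : ℕ) : Type := PosetNerve (CM n)

namespace CM

variable {n : ℕ}

/-- The number `2n - (p + q)` for a contingency matrix of size `p × q`. -/
def cellDim (M : CM n) : ℕ := 2 * n - (M.rows + M.cols)

/-- `F(M)`: the nerve of the lower interval of matrices `≤ M`. -/
noncomputable abbrev F (M : CM n) : Type := PosetNerve (Set.Iic M)

/-- `F'(M)`: the nerve of the strict lower interval of matrices `< M`. -/
noncomputable abbrev F' (M : CM n) : Type := PosetNerve (Set.Iio M)

/-- `F(M)` as a subset of the stochastihedron. -/
noncomputable def closedFace (M : CM n) : Set (Stochastihedron n) :=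
  Set.range (PosetNerve.incl (Set.Iic M))

/-- `F'(M)` as a subset of the stochastihedron. -/
noncomputable def boundaryFace (M : CM n) : Set (Stochastihedron n) :=
  Set.range (PosetNerve.incl (Set.Iio M))

/-- `F°(M) = F(M) ∖ F'(M)`. -/
noncomputable def openFace (M : CM n) : Set (Stochastihedron n) :=
  M.closedFace \ M.boundaryFace

end CM

/-! A contingency matrix of weight `n` is a configuration of `n` points of the plane, counted with
multiplicity, in which only the order of the abscissas and the order of the ordinates matter; a
contraction merges two adjacent vertical or horizontal lines. A weighted chain of matrices below `M`
averages such configurations: sort the points in each direction, add up their ranks with the weights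
of the chain, and centre the result over each row block (abscissas) and each column block
(ordinates) of `M`. This gives `n` complex numbers labelled by the entries of `M`, whose real parts
sum to zero over each row and whose imaginary parts sum to zero over each column.

The cone over `F'(M)` corresponds bijectively to these configurations. The distances between
consecutive points are the gaps; the chain is recovered from them by a layer-cake decomposition, in
which the weight of a matrix is the length of the set of thresholds `θ` at which contracting all
gaps smaller than `θ` yields this matrix (`CM.keyConf_injOn`, `CM.exists_keyConf_eq`).

A multiset of `d` complex numbers is the same as the `d` lower coefficients of a monic polynomial of
degree `d`. So the labelled configurations form a complex vector space of dimension `n`, and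
centring imposes independent real linear conditions on the subleading coefficients, one for each row
and each column. What remains is a real vector space of dimension `2n - (p + q)`
(`CM.finrank_ker_moments`). After a radial change of each coefficient the parametrization is
homogeneous of degree one (`CM.chainCoords_bijOn`, `CM.chainCoords_smul`).

A continuous homogeneous bijection from the cone over `F'(M)` to a normed space turns `F(M)`, which
is the cone cut off at total mass one, into the closed ball, and `F'(M)` into the sphere
(`PosetNerve.exists_homeomorph_closedBall`). The rest is valid for every finite poset with a
strictly monotone dimension function whose lower intervals are such balls
(`PosetNerve.exists_cellDecomposition`). Realizations of nerves are handled throughout by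
barycentric coordinates, which embed them as closed subsets of `T → ℝ`. -/

/-! ### Points of geometric realizations -/

namespace SSet

open Opposite

/-- The characteristic map `Δᵐ → |X|` of an `m`-simplex of a simplicial set `X`. -/
noncomputable def charMap (X : SSet.{0}) {m : SimplexCategory} (a : X.obj (op m))
    (s : _root_.stdSimplex ℝ (Fin (m.len + 1))) : SSet.toTop.obj X :=
  SSet.toTop.map (SSet.yonedaEquiv.symm a) (m.toTopHomeo.symm s)

theorem continuous_charMap (X : SSet.{0}) {m : SimplexCategory} (a : X.obj (op m)) :
    Continuous (X.charMap a) :=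
  (SSet.toTop.map (SSet.yonedaEquiv.symm a)).hom.continuous.comp m.toTopHomeo.symm.continuous

theorem charMap_map (X : SSet.{0}) {m k : SimplexCategory} (f : m ⟶ k) (a : X.obj (op k))
    (s : _root_.stdSimplex ℝ (Fin (m.len + 1))) :
    X.charMap (X.map f.op a) s = X.charMap a (_root_.stdSimplex.map f s) := by
  unfold charMap
  rw [SimplexCategory.toTopHomeo_symm_naturality_apply,
    ← _root_.SSet.yonedaEquiv_symm_naturality_left, Functor.map_comp]
  rfl

theorem toTop_map_charMap {X Y : SSet.{0}} (g : X ⟶ Y) {m : SimplexCategory} (a : X.obj (op m))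
    (s : _root_.stdSimplex ℝ (Fin (m.len + 1))) :
    SSet.toTop.map g (X.charMap a s) = Y.charMap (g.app _ a) s := by
  unfold charMap
  rw [← SSet.yonedaEquiv_symm_comp, Functor.map_comp]
  rfl

/-- Through the adjunction with the singular complex, maps out of a realization can be built and
compared simplex by simplex. -/
theorem homEquiv_app_apply {X : SSet.{0}} {Y : TopCat.{0}} (f : SSet.toTop.obj X ⟶ Y)
    {m : SimplexCategory} (a : X.obj (op m)) (s : _root_.stdSimplex ℝ (Fin (m.len + 1))) :
    Y.toSSetObjEquiv _ ((sSetTopAdj.homEquiv X Y f).app (op m) a) s = f (X.charMap a s) := by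
  rw [Adjunction.homEquiv_unit]
  have h := sSetTopAdj_unit_app_app_down X (op m) a
  have h2 : (((sSetTopAdj.unit.app X ≫ TopCat.toSSet.map f).app (op m)) a).down =
    ((sSetTopAdj.unit.app X).app (op m) a).down ≫ f := rfl
  rw [h] at h2
  exact ConcreteCategory.congr_hom (C := TopCat) h2 (ULift.up s)

theorem toTop_hom_ext {X : SSet.{0}} {Y : TopCat.{0}} {f g : SSet.toTop.obj X ⟶ Y}
    (h : ∀ (m : SimplexCategory) (a : X.obj (op m)) s, f (X.charMap a s) = g (X.charMap a s)) :
    f = g := by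
  apply (sSetTopAdj.homEquiv X Y).injective
  ext m a
  apply (Y.toSSetObjEquiv _).injective
  ext s
  have h1 := homEquiv_app_apply f (m := m.unop) a s
  have h2 := homEquiv_app_apply g (m := m.unop) a s
  exact h1.trans ((h _ _ _).trans h2.symm)

/-- Every map to the indiscrete space `Prop` is continuous. The predicate of lying in the image of
some characteristic map agrees with the constant `True` on all simplices, hence everywhere by
`toTop_hom_ext`. -/
theorem exists_charMap_eq (X : SSet.{0}) (x : SSet.toTop.obj X) :
    ∃ (m : SimplexCategory) (a : X.obj (op m)) (s : _), X.charMap a s = x := by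
  let R : Set (SSet.toTop.obj X) := {x | ∃ (m : SimplexCategory) (a : X.obj (op m)) (s : _),
    X.charMap a s = x}
  let _ : TopologicalSpace Prop := ⊤
  let Y : TopCat.{0} := TopCat.of Prop
  let f : SSet.toTop.obj X ⟶ Y := TopCat.ofHom ⟨fun x => x ∈ R, continuous_top⟩
  let g : SSet.toTop.obj X ⟶ Y := TopCat.ofHom ⟨fun _ => True, continuous_top⟩
  have hfg : f = g := toTop_hom_ext fun m a s => eq_true ⟨m, a, s, rfl⟩
  have := ConcreteCategory.congr_hom hfg x
  exact of_eq_true this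

end SSet

/-! ### Barycentric coordinates on nerves of finite posets -/

namespace PosetNerve

open Opposite Classical

/-- The push-forward of a weight function along a map. -/
noncomputable def pushWeight {ι T : Type} [Fintype ι] (φ : ι → T) (s : ι → ℝ) : T → ℝ :=
  fun x => ∑ i, if φ i = x then s i else 0

theorem continuous_pushWeight {ι T : Type} [Fintype ι] (φ : ι → T) :
    Continuous (pushWeight φ) := by
  unfold pushWeight
  refine continuous_pi fun x => continuous_finsetSum _ fun i _ => ?_
  split_ifs <;> fun_prop

/-- This compatibility with faces and degeneracies lets the weights descend to the realization: it
is the naturality of `baryHom`. -/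
theorem pushWeight_map {ι κ T : Type} [Fintype ι] [Fintype κ] (f : ι → κ) (φ : κ → T)
    (s : stdSimplex ℝ ι) : pushWeight φ (stdSimplex.map f s) = pushWeight (φ ∘ f) s := by
  ext x
  simp only [pushWeight, stdSimplex.map_coe, FunOnFinite.linearMap_apply_apply, Function.comp]
  have : ∀ k, (if φ k = x then ∑ i with f i = k, s i else 0) =
      ∑ i with f i = k, if φ (f i) = x then s i else 0 := by
    intro k
    split_ifs with h
    · refine Finset.sum_congr rfl fun i hi => ?_
      rw [(Finset.mem_filter.1 hi).2, if_pos h]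
    · refine (Finset.sum_eq_zero fun i hi => ?_).symm
      rw [(Finset.mem_filter.1 hi).2, if_neg h]
  simp only [this]
  exact Finset.sum_fiberwise Finset.univ f fun i => if φ (f i) = x then s i else 0

variable {T : Type} [PartialOrder T]

/-- The simplex of the nerve given by a monotone map. -/
def simplexOf {m : SimplexCategory} {φ : Fin (m.len + 1) → T} (hφ : Monotone φ) :
    (nerve T).obj (op m) :=
  hφ.functor

theorem eq_simplexOf {m : SimplexCategory} (a : (nerve T).obj (op m)) :
    ∃ (φ : Fin (m.len + 1) → T) (hφ : Monotone φ), a = simplexOf hφ :=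
  ⟨a.obj, a.monotone, nerve.ext_of_isThin rfl⟩

/-- The morphism of simplicial sets that corresponds to `bary` by adjunction. -/
noncomputable def baryHom (T : Type) [PartialOrder T] :
    nerve T ⟶ TopCat.toSSet.obj (TopCat.of (T → ℝ)) where
  app m := ↾fun a => ((TopCat.of (T → ℝ)).toSSetObjEquiv m).symm
    ⟨fun s => pushWeight a.obj s, (continuous_pushWeight _).comp continuous_subtype_val⟩
  naturality m k f := by
    ext a
    apply ((TopCat.of (T → ℝ)).toSSetObjEquiv k).injective
    ext s : 1
    exact (pushWeight_map (f.unop : _ → _) a.obj s).symm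

/-- Barycentric coordinates on the realization of the nerve of a poset. -/
noncomputable def bary (T : Type) [PartialOrder T] : PosetNerve T → T → ℝ :=
  ((sSetTopAdj.homEquiv (nerve T) (TopCat.of (T → ℝ))).symm (baryHom T)).hom

theorem continuous_bary : Continuous (bary T) :=
  ((sSetTopAdj.homEquiv (nerve T) (TopCat.of (T → ℝ))).symm (baryHom T)).hom.continuous

theorem bary_charMap {m : SimplexCategory} {φ : Fin (m.len + 1) → T} (hφ : Monotone φ)
    (s : stdSimplex ℝ (Fin (m.len + 1))) :
    bary T ((nerve T).charMap (simplexOf hφ) s) = pushWeight φ s := by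
  have h := SSet.homEquiv_app_apply
    ((sSetTopAdj.homEquiv (nerve T) (TopCat.of (T → ℝ))).symm (baryHom T)) (simplexOf hφ) s
  rw [Equiv.apply_symm_apply] at h
  exact h.symm

end PosetNerve

/-! ### Normal forms of points and the embedding by barycentric coordinates. -/

namespace PosetNerve

open Opposite Classical

variable {T : Type} [PartialOrder T]

/-- The point with barycentric coordinates `s` in the simplex `φ` of the nerve. -/
noncomputable def pt {k : ℕ} {φ : Fin (k + 1) → T} (hφ : Monotone φ)
    (s : stdSimplex ℝ (Fin (k + 1))) : PosetNerve T :=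
  (nerve T).charMap (m := SimplexCategory.mk k) (simplexOf (m := SimplexCategory.mk k) hφ) s

theorem continuous_pt {k : ℕ} {φ : Fin (k + 1) → T} (hφ : Monotone φ) : Continuous (pt hφ) :=
  SSet.continuous_charMap _ _

theorem bary_pt {k : ℕ} {φ : Fin (k + 1) → T} (hφ : Monotone φ)
    (s : stdSimplex ℝ (Fin (k + 1))) : bary T (pt hφ s) = pushWeight φ s :=
  bary_charMap (m := SimplexCategory.mk k) hφ s

theorem pt_comp {k l : ℕ} {φ : Fin (k + 1) → T} (hφ : Monotone φ) (f : Fin (l + 1) →o Fin (k + 1))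
    (s : stdSimplex ℝ (Fin (l + 1))) : pt (hφ.comp f.monotone) s = pt hφ (stdSimplex.map f s) :=
  (nerve T).charMap_map (SimplexCategory.mkHom f) (simplexOf (m := SimplexCategory.mk k) hφ) s

theorem exists_pt_eq (x : PosetNerve T) :
    ∃ (k : ℕ) (φ : Fin (k + 1) → T) (hφ : Monotone φ) (s : _), pt hφ s = x := by
  obtain ⟨m, a, s, h⟩ := (nerve T).exists_charMap_eq x
  obtain ⟨φ, hφ, rfl⟩ := eq_simplexOf a
  exact ⟨m.len, φ, hφ, s, h⟩

/-- Each point of the realization lies in the interior of a non-degenerate simplex. -/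
theorem exists_strictMono_pt_eq (x : PosetNerve T) :
    ∃ (k : ℕ) (φ : Fin (k + 1) → T) (hφ : StrictMono φ) (s : stdSimplex ℝ (Fin (k + 1))),
      (∀ i, 0 < s i) ∧ pt hφ.monotone s = x := by
  -- Take a representation of least dimension. A repeated vertex could be merged and a vertex of
  -- weight zero could be dropped, each time lowering the dimension.
  have hex := exists_pt_eq x
  obtain ⟨φ, hφ, s, hx⟩ := Nat.find_spec hex
  have hmin := fun m => Nat.find_min hex (m := m)
  generalize Nat.find hex = k at φ hφ s hx hmin
  refine ⟨k, φ, ?_, s, ?_, hx⟩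
  · rw [Fin.strictMono_iff_lt_succ]
    intro i
    refine lt_of_le_of_ne (hφ (Fin.castSucc_lt_succ).le) fun heq => ?_
    obtain _ | k := k
    · exact i.elim0
    refine hmin k (Nat.lt_succ_self k) ⟨φ ∘ i.succ.succAbove,
      hφ.comp (Fin.strictMono_succAbove _).monotone,
      stdSimplex.map i.predAboveOrderHom s, ?_⟩
    rw [← pt_comp]
    convert hx using 2
    funext j
    simp only [Function.comp, Fin.predAboveOrderHom_coe]
    rcases eq_or_ne j i.succ with rfl | hj
    · rw [Fin.predAbove_succ_self, Fin.succAbove_succ_self, heq]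
    · rw [Fin.succ_succAbove_predAbove hj]
  · intro i
    refine lt_of_le_of_ne (s.2.1 i) fun heq => ?_
    obtain _ | k := k
    · have h1 := s.2.2
      rw [Fin.sum_univ_one, ← Fin.fin_one_eq_zero i] at h1
      exact zero_ne_one (heq.trans h1)
    have hs' : (fun j => s (i.succAbove j)) ∈ stdSimplex ℝ (Fin (k + 1)) := by
      refine ⟨fun j => s.2.1 _, ?_⟩
      have h1 := s.2.2
      rw [Fin.sum_univ_succAbove _ i, show s.1 i = 0 from heq.symm, zero_add] at h1
      exact h1
    refine hmin k (Nat.lt_succ_self k) ⟨φ ∘ i.succAbove,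
      hφ.comp (Fin.strictMono_succAbove _).monotone, ⟨_, hs'⟩, ?_⟩
    rw [← hx]
    refine (pt_comp hφ (Fin.succAboveOrderEmb i).toOrderHom _).trans ?_
    congr 1
    ext j
    rw [stdSimplex.map_coe, FunOnFinite.linearMap_apply_apply]
    rcases eq_or_ne j i with rfl | hj
    · rw [← heq]
      refine Finset.sum_eq_zero fun l hl => ?_
      exact absurd (Finset.mem_filter.1 hl).2 (Fin.succAbove_ne j l)
    · obtain ⟨l, rfl⟩ := Fin.exists_succAbove_eq hj
      rw [Finset.sum_eq_single l]
      · rfl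
      · intro b hb hbl
        exact absurd (Fin.succAbove_right_injective (Finset.mem_filter.1 hb).2) hbl
      · intro h
        exact absurd (Finset.mem_filter.2 ⟨Finset.mem_univ l, rfl⟩ :
          l ∈ Finset.univ.filter fun x => i.succAbove x = i.succAbove l) h

theorem pushWeight_apply_of_injective {ι T : Type} [Fintype ι] {φ : ι → T}
    (hφ : Function.Injective φ) (s : ι → ℝ) (i : ι) : pushWeight φ s (φ i) = s i := by
  simp only [pushWeight, hφ.eq_iff]
  simp

theorem pushWeight_apply_eq_zero {ι T : Type} [Fintype ι] {φ : ι → T} (s : ι → ℝ) {x : T}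
    (hx : x ∉ Set.range φ) : pushWeight φ s x = 0 :=
  Finset.sum_eq_zero fun i _ => if_neg fun h => hx ⟨i, h⟩

theorem support_pushWeight {ι T : Type} [Fintype ι] {φ : ι → T} (hφ : Function.Injective φ)
    {s : ι → ℝ} (hs : ∀ i, 0 < s i) : Function.support (pushWeight φ s) = Set.range φ := by
  ext x
  rw [Function.mem_support]
  constructor
  · exact fun h => by_contra fun h' => h (pushWeight_apply_eq_zero s h')
  · rintro ⟨i, rfl⟩
    rw [pushWeight_apply_of_injective hφ]
    exact (hs i).ne'

/-- For a point in normal form, the support of the coordinates is the chain and their values on it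
are the weights. -/
theorem bary_injective : Function.Injective (bary T) := by
  intro x y hxy
  obtain ⟨k, φ, hφ, s, hs, rfl⟩ := exists_strictMono_pt_eq x
  obtain ⟨l, ψ, hψ, r, hr, rfl⟩ := exists_strictMono_pt_eq y
  rw [bary_pt, bary_pt] at hxy
  have hrange : Set.range φ = Set.range ψ := by
    rw [← support_pushWeight hφ.injective hs, hxy, support_pushWeight hψ.injective hr]
  obtain rfl : k = l := by
    have h := congrArg Set.ncard hrange
    rw [← Set.image_univ, ← Set.image_univ, Set.ncard_image_of_injective _ hφ.injective,
      Set.ncard_image_of_injective _ hψ.injective, Set.ncard_univ, Set.ncard_univ] at h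
    simpa using h
  obtain rfl : φ = ψ := (hφ.range_inj hψ).1 hrange
  congr 1
  ext i
  have := congrFun hxy (φ i)
  rwa [pushWeight_apply_of_injective hφ.injective,
    pushWeight_apply_of_injective hφ.injective] at this

/-- A strict chain has at most as many elements as `T`, so finitely many compact simplices cover the
realization. -/
instance compactSpace [Finite T] : CompactSpace (PosetNerve T) := by
  have := Fintype.ofFinite T
  let I := Σ k : Fin (Fintype.card T), Fin (k.1 + 1) →o T
  have hU : (⋃ i : I, Set.range (pt i.2.monotone)) = Set.univ := by
    refine Set.eq_univ_of_forall fun x => ?_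
    obtain ⟨k, φ, hφ, s, -, rfl⟩ := exists_strictMono_pt_eq x
    have hk : k < Fintype.card T := by
      simpa using Fintype.card_le_of_injective φ hφ.injective
    exact Set.mem_iUnion.2 ⟨⟨⟨k, hk⟩, ⟨φ, hφ.monotone⟩⟩, s, rfl⟩
  have hfin : ∀ k : ℕ, Finite (Fin (k + 1) →o T) := fun k =>
    Finite.of_injective (fun f => (f : Fin (k + 1) → T)) DFunLike.coe_injective
  have : Finite I := Finite.instSigma
  constructor
  rw [← hU]
  exact isCompact_iUnion fun i => isCompact_range (continuous_pt _)

theorem isClosedEmbedding_bary [Finite T] : Topology.IsClosedEmbedding (bary T) :=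
  continuous_bary.isClosedEmbedding bary_injective

/-- The weight functions of total mass `1` supported on a chain contained in `A`: the barycentric
coordinates of the points of the realization of the nerve of `A`. -/
def chainWeights {T : Type} [Fintype T] [PartialOrder T] (A : Set T) : Set (T → ℝ) :=
  {t | (∀ x, 0 ≤ t x) ∧ ∑ x, t x = 1 ∧ IsChain (· ≤ ·) (Function.support t) ∧
    Function.support t ⊆ A}

theorem sum_pushWeight {ι T : Type} [Fintype ι] [Fintype T] (φ : ι → T) (s : ι → ℝ) :
    ∑ x, pushWeight φ s x = ∑ i, s i := by
  unfold pushWeight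
  rw [Finset.sum_comm]
  simp

theorem range_bary [Fintype T] : Set.range (bary T) = chainWeights Set.univ := by
  ext t
  constructor
  · rintro ⟨x, rfl⟩
    obtain ⟨k, φ, hφ, s, hs, rfl⟩ := exists_strictMono_pt_eq x
    rw [bary_pt]
    refine ⟨fun x => Finset.sum_nonneg fun i _ => ?_, ?_, ?_, Set.subset_univ _⟩
    · split_ifs
      exacts [s.2.1 i, le_rfl]
    · rw [sum_pushWeight]
      exact s.2.2
    · rw [support_pushWeight hφ.injective hs]
      rintro _ ⟨i, rfl⟩ _ ⟨j, rfl⟩ -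
      exact (le_total i j).imp (fun h => hφ.monotone h) (fun h => hφ.monotone h)
  · rintro ⟨h0, h1, hc, -⟩
    -- The support is a finite non-empty linear order; its increasing enumeration is the simplex
    -- that carries `t`.
    let _ : LinearOrder (Function.support t) := hc.linearOrder
    have hpos : 0 < Fintype.card (Function.support t) := by
      rw [Fintype.card_pos_iff]
      by_contra hne
      have : ∀ x, t x = 0 := fun x => by_contra fun hx => hne ⟨⟨x, hx⟩⟩
      simp [this] at h1
    obtain ⟨k, hk⟩ : ∃ k, Fintype.card (Function.support t) = k + 1 :=
      ⟨_, (Nat.succ_pred_eq_of_pos hpos).symm⟩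
    let e := monoEquivOfFin (Function.support t) hk
    let φ : Fin (k + 1) → T := fun i => (e i).1
    have hφ : Monotone φ := fun i j hij => e.monotone hij
    have hinj : Function.Injective φ := Subtype.val_injective.comp e.injective
    have hrange : Set.range φ = Function.support t := by
      ext x
      constructor
      · rintro ⟨i, rfl⟩
        exact (e i).2
      · intro hx
        exact ⟨e.symm ⟨x, hx⟩, by simp [φ]⟩
    have hpush : pushWeight φ (t ∘ φ) = t := by
      ext x
      by_cases hx : x ∈ Set.range φ
      · obtain ⟨i, rfl⟩ := hx
        rw [pushWeight_apply_of_injective hinj]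
        rfl
      · rw [pushWeight_apply_eq_zero _ hx]
        rw [hrange] at hx
        exact (Function.notMem_support.1 hx).symm
    refine ⟨pt hφ ⟨t ∘ φ, fun i => h0 _, ?_⟩, ?_⟩
    · rw [← sum_pushWeight φ, hpush, h1]
    · rw [bary_pt]
      exact hpush

theorem incl_pt (A : Set T) {k : ℕ} {φ : Fin (k + 1) → A} (hφ : Monotone φ)
    (s : stdSimplex ℝ (Fin (k + 1))) :
    incl A (pt hφ s) = pt ((Subtype.mono_coe (· ∈ A)).comp hφ) s :=
  SSet.toTop_map_charMap (nerveMap (Subtype.mono_coe (· ∈ A)).functor) _ s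

theorem bary_incl (A : Set T) (x : PosetNerve A) (a : A) :
    bary T (incl A x) a = bary A x a := by
  obtain ⟨k, φ, hφ, s, rfl⟩ := exists_pt_eq x
  rw [incl_pt, bary_pt, bary_pt]
  simp only [pushWeight, Subtype.ext_iff, Function.comp]

theorem bary_incl_eq_zero (A : Set T) (x : PosetNerve A) {a : T} (ha : a ∉ A) :
    bary T (incl A x) a = 0 := by
  obtain ⟨k, φ, hφ, s, rfl⟩ := exists_pt_eq x
  rw [incl_pt, bary_pt]
  refine pushWeight_apply_eq_zero _ ?_
  rintro ⟨i, rfl⟩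
  exact ha (φ i).2

theorem continuous_incl (A : Set T) : Continuous (incl A) :=
  (SSet.toTop.map (nerveMap (Subtype.mono_coe (· ∈ A)).functor)).hom.continuous

theorem isClosedEmbedding_incl [Finite T] (A : Set T) : Topology.IsClosedEmbedding (incl A) := by
  have : T2Space (PosetNerve T) := isClosedEmbedding_bary.isEmbedding.t2Space
  refine (continuous_incl A).isClosedEmbedding fun x y hxy => bary_injective ?_
  ext a
  rw [← bary_incl, ← bary_incl, hxy]

/-- In coordinates, the inclusion of the nerve of `A` is extension by zero. -/
theorem range_bary_comp_incl [Fintype T] (A : Set T) :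
    Set.range (bary T ∘ incl A) = chainWeights A := by
  ext t
  constructor
  · rintro ⟨x, rfl⟩
    have h : bary T (incl A x) ∈ chainWeights Set.univ := by
      rw [← range_bary]
      exact ⟨_, rfl⟩
    refine ⟨h.1, h.2.1, h.2.2.1, fun a ha => ?_⟩
    by_contra haA
    exact ha (bary_incl_eq_zero A x haA)
  · rintro ⟨h0, h1, hc, hA⟩
    have hout : ∀ a, a ∉ A → t a = 0 := fun a ha => by_contra fun h => ha (hA h)
    have : (fun a : A => t a) ∈ chainWeights (Set.univ : Set A) := by
      refine ⟨fun a => h0 a, ?_, ?_, Set.subset_univ _⟩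
      · rw [← h1]
        refine Eq.trans ?_ (Finset.sum_subset (Finset.filter_subset (· ∈ A) _) fun a _ ha => ?_)
        · exact (Finset.sum_subtype _ (by simp) _).symm
        · exact hout a fun h => ha (by simp [h])
      · intro a ha b hb hab
        exact hc ha hb (fun h => hab (Subtype.ext h))
    rw [← range_bary] at this
    obtain ⟨x, hx⟩ := this
    refine ⟨x, ?_⟩
    ext a
    by_cases ha : a ∈ A
    · exact (bary_incl A x ⟨a, ha⟩).trans (congrFun hx ⟨a, ha⟩)
    · exact (bary_incl_eq_zero A x ha).trans (hout a ha).symm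

/-- The realization of the nerve of `A` in terms of barycentric coordinates. -/
noncomputable def homeomorphChainWeights [Fintype T] (A : Set T) :
    PosetNerve A ≃ₜ chainWeights A :=
  (isClosedEmbedding_bary.comp (isClosedEmbedding_incl A)).isEmbedding.toHomeomorph.trans
    (Homeomorph.setCongr (range_bary_comp_incl A))

theorem range_incl [Fintype T] (A : Set T) :
    Set.range (incl A) = bary T ⁻¹' chainWeights A := by
  rw [← range_bary_comp_incl, Set.range_comp, Set.preimage_image_eq _ bary_injective]

end PosetNerve

/-! ### Stars in the nerve of a finite poset, and their cell decomposition. -/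

namespace PosetNerve

open Opposite Classical

/-- A homeomorphism between subspaces restricts to smaller subspaces that correspond. -/
def _root_.Homeomorph.restrictSubsets {X Y : Type} [TopologicalSpace X] [TopologicalSpace Y]
    {s s' : Set X} {u u' : Set Y} (h : s ≃ₜ u) (hs : s' ⊆ s) (hu : u' ⊆ u)
    (hh : ∀ x : s, x.1 ∈ s' ↔ (h x).1 ∈ u') : s' ≃ₜ u' where
  toFun x := ⟨h ⟨x.1, hs x.2⟩, (hh _).1 x.2⟩
  invFun y := ⟨h.symm ⟨y.1, hu y.2⟩, (hh _).2 (by simp)⟩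
  left_inv x := by simp
  right_inv y := by simp
  continuous_toFun := by fun_prop
  continuous_invFun := by fun_prop

section

variable {T : Type} [PartialOrder T]

/-- The subspace of points supported in the lower interval of `M`. -/
def closedStar (M : T) : Set (PosetNerve T) := Set.range (incl (Set.Iic M))

/-- The subspace of points of `closedStar M` not supported below `M`. -/
def openStar (M : T) : Set (PosetNerve T) := closedStar M \ Set.range (incl (Set.Iio M))

theorem openStar_subset (M : T) : openStar M ⊆ closedStar M := Set.sdiff_subset

theorem isOpen_pos (M : T) : IsOpen {x : PosetNerve T | 0 < bary T x M} :=
  isOpen_lt continuous_const ((continuous_apply M).comp continuous_bary)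

end

variable {T : Type} [Fintype T] [PartialOrder T]

theorem bary_mem (x : PosetNerve T) : bary T x ∈ chainWeights Set.univ := by
  rw [← range_bary]
  exact ⟨x, rfl⟩

theorem exists_isGreatest_support (x : PosetNerve T) :
    ∃ M, IsGreatest (Function.support (bary T x)) M := by
  obtain ⟨-, h1, hc, -⟩ := bary_mem x
  have hne : (Function.support (bary T x)).Nonempty := by
    by_contra hne
    rw [Set.not_nonempty_iff_eq_empty, Function.support_eq_empty_iff] at hne
    simp [hne] at h1
  obtain ⟨M, hM⟩ := (Set.toFinite (Function.support (bary T x))).exists_maximal hne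
  refine ⟨M, hM.1, fun N hN => ?_⟩
  rcases hc.total hN hM.1 with h | h
  exacts [h, hM.2 hN h]

/-- The largest element of the support of a point of the nerve. -/
noncomputable def top (x : PosetNerve T) : T := (exists_isGreatest_support x).choose

theorem isGreatest_top (x : PosetNerve T) : IsGreatest (Function.support (bary T x)) (top x) :=
  (exists_isGreatest_support x).choose_spec

theorem mem_range_incl {A : Set T} {x : PosetNerve T} :
    x ∈ Set.range (incl A) ↔ Function.support (bary T x) ⊆ A := by
  rw [range_incl]
  obtain ⟨h0, h1, hc, -⟩ := bary_mem x
  exact ⟨fun h => h.2.2.2, fun h => ⟨h0, h1, hc, h⟩⟩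

theorem mem_closedStar {M : T} {x : PosetNerve T} : x ∈ closedStar M ↔ top x ≤ M := by
  rw [closedStar, mem_range_incl]
  exact ⟨fun h => h (isGreatest_top x).1, fun h N hN => ((isGreatest_top x).2 hN).trans h⟩

/-- Hence the open stars partition the nerve according to the largest element of the support. -/
theorem mem_openStar {M : T} {x : PosetNerve T} : x ∈ openStar M ↔ top x = M := by
  rw [openStar, Set.mem_sdiff, mem_closedStar, mem_range_incl]
  constructor
  · rintro ⟨h1, h2⟩
    refine h1.eq_of_not_lt fun hlt => h2 fun N hN => ?_
    exact lt_of_le_of_lt ((isGreatest_top x).2 hN) hlt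
  · rintro rfl
    exact ⟨le_rfl, fun h => lt_irrefl _ (h (isGreatest_top x).1)⟩

theorem top_pos (x : PosetNerve T) : 0 < bary T x (top x) :=
  lt_of_le_of_ne ((bary_mem x).1 _) (Ne.symm (isGreatest_top x).1)

theorem le_top_of_pos {x : PosetNerve T} {M : T} (h : 0 < bary T x M) : M ≤ top x :=
  (isGreatest_top x).2 h.ne'

theorem isClosed_closedStar (M : T) : IsClosed (closedStar M) :=
  (isClosedEmbedding_incl _).isClosed_range

theorem openStar_nonempty (M : T) : (openStar M).Nonempty := by
  have h : Pi.single M (1 : ℝ) ∈ chainWeights (Set.univ : Set T) := by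
    refine ⟨fun x => ?_, by simp, ?_, Set.subset_univ _⟩
    · rcases eq_or_ne x M with rfl | hx <;> simp [*]
    · exact (Set.subsingleton_singleton.anti Pi.support_single_subset).isChain
  rw [← range_bary] at h
  obtain ⟨x, hx⟩ := h
  refine ⟨x, mem_openStar.2 ?_⟩
  have := (isGreatest_top x).1
  rw [hx] at this
  by_contra hne
  exact this (Pi.single_eq_of_ne hne _)

theorem closedStar_subset_iff {M N : T} : closedStar M ⊆ closedStar N ↔ M ≤ N := by
  constructor
  · intro h
    obtain ⟨x, hx⟩ := openStar_nonempty M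
    have := mem_closedStar.1 (h (openStar_subset M hx))
    rwa [mem_openStar.1 hx] at this
  · exact fun h x hx => mem_closedStar.2 ((mem_closedStar.1 hx).trans h)

/-- `closedStar M` in barycentric coordinates. -/
noncomputable def closedStarHomeomorph (M : T) :
    closedStar M ≃ₜ chainWeights (Set.Iic M) :=
  (isClosedEmbedding_incl (Set.Iic M)).isEmbedding.toHomeomorph.symm.trans
    (homeomorphChainWeights _)

theorem closedStarHomeomorph_apply (M : T) (x : closedStar M) :
    (closedStarHomeomorph M x : T → ℝ) = bary T x := by
  obtain ⟨_, y, rfl⟩ := x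
  have : (isClosedEmbedding_incl (Set.Iic M)).isEmbedding.toHomeomorph.symm
      (⟨incl _ y, y, rfl⟩ : Set.range (incl (Set.Iic M))) = y := by
    rw [Homeomorph.symm_apply_eq]
    rfl
  change ((homeomorphChainWeights (Set.Iic M)) _ : T → ℝ) = _
  erw [this]
  rfl

section Decomposition

variable (dim : T → ℕ)

/-- The points whose carrier has dimension at most `m`. -/
def skeleton (m : ℕ) : Set (PosetNerve T) := {x | dim (top x) ≤ m}

theorem stratum_skeleton (m : ℕ) :
    stratum (skeleton dim) m = {x : PosetNerve T | dim (top x) = m} := by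
  ext x
  cases m with
  | zero => simp [stratum, skeleton]
  | succ m =>
    simp only [stratum, skeleton, Set.mem_sdiff, Set.mem_ofPred_eq]
    omega

theorem isClosed_skeleton (hdim : StrictMono dim) (m : ℕ) : IsClosed (skeleton (T := T) dim m) := by
  have : skeleton (T := T) dim m = ⋃ M ∈ {M : T | dim M ≤ m}, closedStar M := by
    ext x
    simp only [skeleton, Set.mem_ofPred_eq, Set.mem_iUnion, mem_closedStar, exists_prop]
    exact ⟨fun h => ⟨_, h, le_rfl⟩, fun ⟨M, h, hM⟩ => (hdim.monotone hM).trans h⟩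
  rw [this]
  exact (Set.toFinite _).isClosed_biUnion fun M _ => isClosed_closedStar M

variable {dim}

/-- Positive weight at `M` forces `M ≤ top x`, and equal dimension then forces equality. The point
of this form is that the open star is relatively open in its stratum. -/
theorem openStar_eq (hdim : StrictMono dim) (M : T) :
    openStar M = stratum (skeleton dim) (dim M) ∩ {x | 0 < bary T x M} := by
  rw [stratum_skeleton]
  ext x
  rw [mem_openStar, Set.mem_inter_iff, Set.mem_ofPred_eq, Set.mem_ofPred_eq]
  constructor
  · rintro rfl
    exact ⟨rfl, top_pos x⟩
  · rintro ⟨h1, h2⟩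
    refine ((le_top_of_pos h2).eq_of_not_lt fun hlt => ?_).symm
    exact (hdim hlt).ne h1.symm

/-- The support of a point is a chain, and a chain contains at most one element of each dimension.
So the open sets of positive weight at distinct elements of one dimension are disjoint; they cover
the stratum, and a component stays inside one of them. -/
theorem connectedComponentIn_stratum (hdim : StrictMono dim)
    (hconn : ∀ M : T, IsPreconnected (openStar M)) {m : ℕ} {x : PosetNerve T}
    (hx : x ∈ stratum (skeleton dim) m) :
    connectedComponentIn (stratum (skeleton dim) m) x = openStar (top x) := by
  have hm : dim (top x) = m := by
    rw [stratum_skeleton] at hx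
    exact hx
  subst hm
  have hx' : x ∈ openStar (top x) := mem_openStar.2 rfl
  refine Set.Subset.antisymm ?_ ?_
  · have hsub : connectedComponentIn (stratum (skeleton dim) (dim (top x))) x ⊆
        {y | 0 < bary T y (top x)} := by
      refine isPreconnected_connectedComponentIn.subset_left_of_subset_union (isOpen_pos _)
        (v := ⋃ N ∈ {N : T | N ≠ top x ∧ dim N = dim (top x)}, {y | 0 < bary T y N})
        (isOpen_biUnion fun N _ => isOpen_pos N) ?_ ?_ ?_
      · rw [Set.disjoint_iUnion₂_right]
        rintro N ⟨hN, hNd⟩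
        rw [Set.disjoint_left]
        intro y hy hyN
        rcases (bary_mem y).2.2.1 (ne_of_gt hy) (ne_of_gt hyN) (Ne.symm hN) with h | h
        · exact (hdim (lt_of_le_of_ne h hN.symm)).ne hNd.symm
        · exact (hdim (lt_of_le_of_ne h hN)).ne hNd
      · intro y hy
        have hy' := connectedComponentIn_subset _ _ hy
        rw [stratum_skeleton] at hy'
        by_cases h : top y = top x
        · exact Or.inl (h ▸ top_pos y)
        · exact Or.inr (Set.mem_biUnion (x := top y) ⟨h, hy'⟩ (top_pos y))
      · exact ⟨x, mem_connectedComponentIn hx, top_pos x⟩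
    rw [openStar_eq hdim]
    exact Set.subset_inter (connectedComponentIn_subset _ _) hsub
  · refine (hconn _).subset_connectedComponentIn hx' ?_
    rw [openStar_eq hdim]
    exact Set.inter_subset_left

/-- If the lower intervals of a finite poset are closed cells in which the strict lower intervals
correspond to the boundaries, their interiors form a regular cell decomposition of the nerve. -/
theorem exists_cellDecomposition (hdim : StrictMono dim)
    (hball : ∀ M : T, ∃ h : chainWeights (Set.Iic M) ≃ₜ
      Metric.closedBall (0 : EuclideanSpace ℝ (Fin (dim M))) 1,
      ∀ t, 0 < t.1 M ↔ (h t).1 ∈ Metric.ball (0 : EuclideanSpace ℝ (Fin (dim M))) 1) :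
    ∃ D : CellDecomposition (PosetNerve T), D.IsRegular ∧
      (∀ M : T, openStar M ∈ D.cells (dim M) ∧ closure (openStar M) = closedStar M) ∧
      ∃ e : T ≃o D.Cell, ∀ M : T, (e M).1 = openStar M := by
  have H : ∀ M : T, ∃ h : closedStar M ≃ₜ
      Metric.closedBall (0 : EuclideanSpace ℝ (Fin (dim M))) 1,
      ∀ x : closedStar M, x.1 ∈ openStar M ↔
        (h x).1 ∈ Metric.ball (0 : EuclideanSpace ℝ (Fin (dim M))) 1 := by
    intro M
    obtain ⟨h, hh⟩ := hball M
    refine ⟨(closedStarHomeomorph M).trans h, fun x => ?_⟩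
    rw [Homeomorph.trans_apply, ← hh, closedStarHomeomorph_apply, mem_openStar]
    constructor
    · intro hx
      have hpos := top_pos x.1
      rwa [hx] at hpos
    · exact fun hx => le_antisymm (mem_closedStar.1 x.2) (le_top_of_pos hx)
  choose h hh using H
  have hopen : ∀ M : T, IsOpenCell (dim M) (openStar M) := fun M =>
    ⟨(h M).restrictSubsets (openStar_subset M) Metric.ball_subset_closedBall (hh M)⟩
  have hconn : ∀ M : T, IsPreconnected (openStar M) := by
    intro M
    obtain ⟨g⟩ := hopen M
    have : PreconnectedSpace (Metric.ball (0 : EuclideanSpace ℝ (Fin (dim M))) 1) :=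
      isPreconnected_iff_preconnectedSpace.1 (convex_ball _ _).isPreconnected
    have hr := isPreconnected_range (continuous_subtype_val.comp g.symm.continuous)
    rwa [g.symm.surjective.range_comp, Subtype.range_coe] at hr
  have hclosure : ∀ M : T, closure (openStar M) = closedStar M := by
    intro M
    refine Set.Subset.antisymm
      (closure_minimal (openStar_subset M) (isClosed_closedStar M)) fun x hx => ?_
    let B : Set (Metric.closedBall (0 : EuclideanSpace ℝ (Fin (dim M))) 1) :=
      {y | y.1 ∈ Metric.ball (0 : EuclideanSpace ℝ (Fin (dim M))) 1}
    have hB : Dense B := by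
      intro y
      rw [closure_subtype]
      have : (Subtype.val '' B) = Metric.ball (0 : EuclideanSpace ℝ (Fin (dim M))) 1 := by
        ext z
        constructor
        · rintro ⟨w, hw, rfl⟩
          exact hw
        · exact fun hz => ⟨⟨z, Metric.ball_subset_closedBall hz⟩, hz, rfl⟩
      rw [this, closure_ball _ one_ne_zero]
      exact y.2
    have hc : Continuous fun y => ((h M).symm y : PosetNerve T) := by fun_prop
    have := hc.range_subset_closure_image_dense hB
      ⟨h M ⟨x, hx⟩, congrArg Subtype.val ((h M).symm_apply_apply ⟨x, hx⟩)⟩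
    refine closure_mono ?_ this
    rintro _ ⟨y, hy, rfl⟩
    exact (hh M _).2 (by rw [Homeomorph.apply_symm_apply]; exact hy)
  have hcomp := fun (m : ℕ) (x : PosetNerve T) (hx : x ∈ stratum (skeleton dim) m) =>
    connectedComponentIn_stratum hdim hconn hx
  have hdimtop : ∀ (m : ℕ) (x : PosetNerve T), x ∈ stratum (skeleton dim) m → dim (top x) = m := by
    intro m x hx
    rw [stratum_skeleton] at hx
    exact hx
  let D : CellDecomposition (PosetNerve T) :=
    { skel := skeleton dim
      isClosed_skel := isClosed_skeleton dim hdim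
      monotone_skel := fun m k hmk x hx => le_trans hx hmk
      iUnion_skel := Set.eq_univ_of_forall fun x => Set.mem_iUnion.2
        ⟨dim (top x), le_refl (dim (top x))⟩
      isOpen_component := by
        intro m x hx
        refine ⟨_, isOpen_pos (top x), ?_⟩
        rw [hcomp m x hx, openStar_eq hdim, hdimtop m x hx]
      isOpenCell_component := by
        intro m x hx
        rw [hcomp m x hx, ← hdimtop m x hx]
        exact hopen _ }
  have hcell : ∀ M : T, openStar M ∈ D.cells (dim M) := by
    intro M
    obtain ⟨x, hx⟩ := openStar_nonempty M
    have hx' : x ∈ stratum (skeleton dim) (dim M) := by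
      rw [openStar_eq hdim] at hx
      exact hx.1
    refine ⟨x, hx', ?_⟩
    change _ = connectedComponentIn (stratum (skeleton dim) (dim M)) x
    rw [hcomp _ x hx', mem_openStar.1 hx]
  have hcell' : ∀ m, ∀ σ ∈ D.cells m, ∃ M : T, dim M = m ∧ σ = openStar M := by
    rintro m _ ⟨x, hx, rfl⟩
    exact ⟨top x, hdimtop m x hx, hcomp m x hx⟩
  refine ⟨D, ?_, fun M => ⟨hcell M, hclosure M⟩, ?_⟩
  · intro m σ hσ
    obtain ⟨M, rfl, rfl⟩ := hcell' m σ hσ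
    refine ⟨⟨(Homeomorph.setCongr (hclosure M)).trans (h M),
      fun x => hh M (Homeomorph.setCongr (hclosure M) x)⟩,
      {τ | ∃ N < M, τ.1 = openStar N}, ?_⟩
    rw [hclosure]
    ext x
    simp only [Set.mem_sdiff, mem_closedStar, mem_openStar, Set.mem_iUnion, exists_prop,
      Set.mem_ofPred_eq]
    constructor
    · rintro ⟨h1, h2⟩
      exact ⟨⟨openStar (top x), _, hcell _⟩, ⟨top x, lt_of_le_of_ne h1 h2, rfl⟩,
        mem_openStar.2 rfl⟩
    · rintro ⟨τ, ⟨N, hN, hτ⟩, hx⟩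
      rw [hτ, mem_openStar] at hx
      subst hx
      exact ⟨hN.le, hN.ne⟩
  · let f : T → D.Cell := fun M => ⟨openStar M, dim M, hcell M⟩
    have hf : ∀ M N, f M ≤ f N ↔ M ≤ N := by
      intro M N
      change closure (openStar M) ⊆ closure (openStar N) ↔ _
      rw [hclosure, hclosure, closedStar_subset_iff]
    have hbij : Function.Bijective f := by
      constructor
      · intro M N hMN
        exact le_antisymm ((hf M N).1 hMN.le) ((hf N M).1 hMN.ge)
      · rintro ⟨σ, m, hσ⟩
        obtain ⟨M, -, rfl⟩ := hcell' m σ hσ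
        exact ⟨M, rfl⟩
    exact ⟨⟨Equiv.ofBijective f hbij, fun {M N} => hf M N⟩, fun M => rfl⟩

end Decomposition

end PosetNerve

/-! ### From a homogeneous parametrization of a cone to a closed ball. -/

namespace PosetNerve

open Classical

variable {T : Type} [Fintype T] [PartialOrder T]

instance compactSpace_chainWeights (A : Set T) : CompactSpace (chainWeights A) :=
  (homeomorphChainWeights A).compactSpace

/-- The cone over the nerve of the elements below `M`. -/
def chainCone {T : Type} [PartialOrder T] (M : T) : Set (T → ℝ) :=
  {t | (∀ x, 0 ≤ t x) ∧ IsChain (· ≤ ·) (Function.support t) ∧ Function.support t ⊆ Set.Iio M}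

theorem smul_mem_chainCone {T : Type} [PartialOrder T] {M : T} {t : T → ℝ} (ht : t ∈ chainCone M)
    {c : ℝ} (hc : 0 ≤ c) : c • t ∈ chainCone M := by
  have hsub : Function.support (c • t) ⊆ Function.support t := Function.support_const_smul_subset c t
  exact ⟨fun x => mul_nonneg hc (ht.1 x), ht.2.1.mono hsub, hsub.trans ht.2.2⟩

/-- The nerve of the elements `≤ M` is treated as the part of the cone of total mass at most one:
the weight at `M` is forgotten here, and `add_single_mem` restores it as the missing mass. -/
theorem update_mem_chainCone {M : T} {t : T → ℝ} (ht : t ∈ chainWeights (Set.Iic M)) :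
    Function.update t M 0 ∈ chainCone M := by
  have hsub : Function.support (Function.update t M 0) ⊆ Function.support t \ {M} := by
    intro x hx
    rcases eq_or_ne x M with rfl | h
    · simp at hx
    · rw [Function.mem_support, Function.update_of_ne h] at hx
      exact ⟨hx, h⟩
  refine ⟨fun x => ?_, ht.2.2.1.mono (hsub.trans Set.sdiff_subset), fun x hx =>
    lt_of_le_of_ne (ht.2.2.2 (hsub hx).1) (hsub hx).2⟩
  rcases eq_or_ne x M with rfl | h
  · simp
  · rw [Function.update_of_ne h]
    exact ht.1 x

theorem sum_update {M : T} {t : T → ℝ} (ht : t ∈ chainWeights (Set.Iic M)) :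
    ∑ x, Function.update t M 0 x = 1 - t M := by
  rw [Finset.sum_update_of_mem (Finset.mem_univ M), zero_add, ← ht.2.1,
    Finset.sum_eq_add_sum_sdiff_singleton_of_mem (Finset.mem_univ M) t]
  ring

theorem eq_zero_of_sum_eq_zero {T : Type} [Fintype T] {t : T → ℝ} (h0 : ∀ x, 0 ≤ t x) (h : ∑ x, t x = 0) : t = 0 := by
  ext x
  exact (Finset.sum_eq_zero_iff_of_nonneg fun x _ => h0 x).1 h x (Finset.mem_univ x)

theorem add_single_mem {M : T} {t : T → ℝ} (ht : t ∈ chainCone M) {c : ℝ} (hc : 0 ≤ c)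
    (hsum : ∑ x, t x + c = 1) : t + Pi.single M c ∈ chainWeights (Set.Iic M) := by
  have hsub : Function.support (t + Pi.single M c) ⊆ insert M (Function.support t) := by
    intro x hx
    by_contra h
    rw [Set.mem_insert_iff, not_or, Function.notMem_support] at h
    rw [Function.mem_support, Pi.add_apply, h.2, Pi.single_eq_of_ne h.1] at hx
    simp at hx
  refine ⟨fun x => add_nonneg (ht.1 x) ?_, ?_, ?_, ?_⟩
  · rcases eq_or_ne x M with rfl | h <;> simp [*]
  · simp only [Pi.add_apply, Finset.sum_add_distrib, Finset.sum_pi_single', Finset.mem_univ,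
      if_true]
    simpa using hsum
  · refine IsChain.mono hsub (ht.2.1.insert fun x hx _ => Or.inr (ht.2.2 hx).le)
  · intro x hx
    rcases hsub hx with rfl | h
    · exact le_refl x
    · exact (ht.2.2 h).le

/-- A homogeneous parametrization of a vector space by the cone over the nerve of the elements
below `M` makes the nerve of the elements `≤ M` into a closed ball. -/
theorem exists_homeomorph_closedBall {V : Type} [NormedAddCommGroup V] [NormedSpace ℝ V] (M : T)
    (Φ : (T → ℝ) → V) (hcont : ContinuousOn Φ (chainCone M))
    (hbij : Set.BijOn Φ (chainCone M) Set.univ)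
    (hsmul : ∀ t ∈ chainCone M, ∀ c : ℝ, 0 ≤ c → Φ (c • t) = c • Φ t) :
    ∃ h : chainWeights (Set.Iic M) ≃ₜ Metric.closedBall (0 : V) 1,
      ∀ t, 0 < t.1 M ↔ (h t).1 ∈ Metric.ball (0 : V) 1 := by
  have hzero : (0 : T → ℝ) ∈ chainCone M := by
    refine ⟨fun x => le_rfl, ?_, ?_⟩ <;> simp [IsChain]
  have hΦ0 : Φ 0 = 0 := by simpa using hsmul 0 hzero 0 le_rfl
  have hΦne : ∀ t ∈ chainCone M, Φ t = 0 → t = 0 := fun t ht h =>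
    hbij.injOn ht hzero (h.trans hΦ0.symm)
  let r : chainWeights (Set.Iic M) → T → ℝ := fun t => Function.update t.1 M 0
  have hr : ∀ t, r t ∈ chainCone M := fun t => update_mem_chainCone t.2
  have hrsum : ∀ t, ∑ x, r t x = 1 - t.1 M := fun t => sum_update t.2
  have hle : ∀ t : chainWeights (Set.Iic M), 0 ≤ 1 - t.1 M := fun t => by
    rw [← hrsum]
    exact Finset.sum_nonneg fun x _ => (hr t).1 x
  have hr0 : ∀ t, Φ (r t) = 0 → 1 - t.1 M = 0 := fun t h => by
    rw [← hrsum, hΦne _ (hr t) h]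
    simp
  have hrc : Continuous r := by
    have : Continuous fun t : chainWeights (Set.Iic M) => t.1 := continuous_subtype_val
    exact this.update M continuous_const
  have hΦr : Continuous fun t => Φ (r t) := hcont.comp_continuous hrc hr
  -- Rescaled radially, the image has norm equal to the mass of `r t`. Where `Φ (r t) = 0` the
  -- quotient is `0` by convention, which is the right value because the mass vanishes there too.
  let G : chainWeights (Set.Iic M) → V := fun t => ((1 - t.1 M) / ‖Φ (r t)‖) • Φ (r t)
  have hnorm : ∀ t, ‖G t‖ = 1 - t.1 M := by
    intro t
    simp only [G, norm_smul, norm_div, norm_norm, Real.norm_of_nonneg (hle t)]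
    by_cases h : Φ (r t) = 0
    · simp [h, hr0 t h]
    · field_simp [norm_ne_zero_iff.2 h]
  have hcoordc : Continuous fun t : chainWeights (Set.Iic M) => 1 - t.1 M :=
    continuous_const.sub ((continuous_apply M).comp continuous_subtype_val)
  have hGc : Continuous G := by
    rw [continuous_iff_continuousAt]
    intro t
    by_cases h : Φ (r t) = 0
    -- At the apex the direction of `G` is undefined, but its norm is a continuous function that
    -- tends to zero.
    · have hG : G t = 0 := by simp [G, h]
      rw [ContinuousAt, hG, tendsto_zero_iff_norm_tendsto_zero]
      simp only [hnorm]
      rw [← hr0 t h]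
      exact hcoordc.continuousAt
    · exact (hcoordc.continuousAt.div hΦr.continuousAt.norm (norm_ne_zero_iff.2 h)).smul
        hΦr.continuousAt
  have hGmem : ∀ t, G t ∈ Metric.closedBall (0 : V) 1 := by
    intro t
    rw [mem_closedBall_zero_iff, hnorm]
    have := t.2.1 M
    linarith
  have hext : ∀ t t' : chainWeights (Set.Iic M), r t = r t' → t = t' := by
    intro t t' h
    ext x
    rcases eq_or_ne x M with rfl | hx
    · have h1 := hrsum t
      rw [h, hrsum] at h1
      linarith
    · have := congrFun h x
      simpa [r, Function.update_of_ne hx] using this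
  have hinj : Function.Injective G := by
    intro t t' h
    have hs : 1 - t.1 M = 1 - t'.1 M := by rw [← hnorm, h, hnorm]
    refine hext t t' ?_
    by_cases h0 : 1 - t.1 M = 0
    · rw [eq_zero_of_sum_eq_zero (hr t).1 ((hrsum t).trans h0),
        eq_zero_of_sum_eq_zero (hr t').1 ((hrsum t').trans (hs ▸ h0))]
    have hne : ∀ t : chainWeights (Set.Iic M), 1 - t.1 M ≠ 0 → ‖Φ (r t)‖ ≠ 0 := fun t h h' =>
      h (hr0 t (norm_eq_zero.1 h'))
    have e1 := hne t h0
    have e2 := hne t' (hs ▸ h0)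
    have hpos : ∀ t : chainWeights (Set.Iic M), 0 ≤ (1 - t.1 M) / ‖Φ (r t)‖ := fun t =>
      div_nonneg (hle t) (norm_nonneg _)
    -- By homogeneity `h` is an equality of two values of `Φ` on the cone, so injectivity applies.
    -- Comparing total masses then shows that the two scalars agree.
    have key : ((1 - t.1 M) / ‖Φ (r t)‖) • r t = ((1 - t'.1 M) / ‖Φ (r t')‖) • r t' := by
      refine hbij.injOn (smul_mem_chainCone (hr t) (hpos t)) (smul_mem_chainCone (hr t') (hpos t')) ?_
      rw [hsmul _ (hr t) _ (hpos t), hsmul _ (hr t') _ (hpos t')]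
      exact h
    have hsum := congrArg (fun f : T → ℝ => ∑ x, f x) key
    simp only [Pi.smul_apply, smul_eq_mul, ← Finset.mul_sum, hrsum] at hsum
    rw [← hs] at hsum key
    have hc : (1 - t.1 M) / ‖Φ (r t)‖ = (1 - t.1 M) / ‖Φ (r t')‖ := mul_right_cancel₀ h0 hsum
    rw [← hc] at key
    exact smul_right_injective _ (div_ne_zero h0 e1) key
  have hsurj : ∀ v ∈ Metric.closedBall (0 : V) 1, ∃ t, G t = v := by
    intro v hv
    rw [mem_closedBall_zero_iff] at hv
    obtain ⟨k, hk, rfl⟩ := hbij.surjOn (Set.mem_univ v)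
    -- The factor `a` brings `k` to total mass `‖Φ k‖`; the missing mass `1 - ‖Φ k‖` is placed at
    -- `M`.
    have key : ∀ a : ℝ, 0 ≤ a → a * ∑ x, k x = ‖Φ k‖ → ∃ t, G t = Φ k := by
      intro a ha hak
      have hmem := smul_mem_chainCone hk ha
      have hsum : ∑ x, (a • k) x + (1 - ‖Φ k‖) = 1 := by
        simp only [Pi.smul_apply, smul_eq_mul, ← Finset.mul_sum, hak]
        ring
      refine ⟨⟨_, add_single_mem hmem (sub_nonneg.2 hv) hsum⟩, ?_⟩
      have hkM : k M = 0 := by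
        by_contra h
        exact lt_irrefl M (hk.2.2 h)
      have hrk : Function.update (a • k + Pi.single M (1 - ‖Φ k‖)) M 0 = a • k := by
        ext x
        rcases eq_or_ne x M with rfl | hx
        · simp [hkM]
        · simp [hx]
      simp only [G, r, hrk]
      rw [hsmul _ hk _ ha, norm_smul, Real.norm_of_nonneg ha, smul_smul]
      simp only [Pi.add_apply, Pi.smul_apply, hkM, Pi.single_eq_same, smul_zero, zero_add]
      by_cases h : Φ k = 0
      · simp [h]
      have hn := norm_ne_zero_iff.2 h
      have ha' : a ≠ 0 := by
        rintro rfl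
        exact hn (by rw [← hak, zero_mul])
      have : (1 - (1 - ‖Φ k‖)) / (a * ‖Φ k‖) * a = 1 := by
        field_simp
        ring
      rw [this, one_smul]
    by_cases h : ∑ x, k x = 0
    · refine key 0 le_rfl ?_
      rw [eq_zero_of_sum_eq_zero hk.1 h, hΦ0]
      simp
    · exact key (‖Φ k‖ / ∑ x, k x)
        (div_nonneg (norm_nonneg _) (Finset.sum_nonneg fun x _ => hk.1 x)) (div_mul_cancel₀ _ h)
  let g : chainWeights (Set.Iic M) → Metric.closedBall (0 : V) 1 := fun t => ⟨G t, hGmem t⟩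
  have hgbij : Function.Bijective g := by
    refine ⟨fun t t' h => hinj (congrArg Subtype.val h), fun v => ?_⟩
    obtain ⟨t, ht⟩ := hsurj v.1 v.2
    exact ⟨t, Subtype.ext ht⟩
  have hgc : Continuous g := hGc.subtype_mk _
  refine ⟨Continuous.homeoOfEquivCompactToT2 (f := Equiv.ofBijective g hgbij) hgc, fun t => ?_⟩
  change _ ↔ G t ∈ _
  rw [mem_ball_zero_iff, hnorm]
  constructor <;> intro h <;> linarith

end PosetNerve

/-! ### Contingency matrices as configurations of lattice points -/

namespace CM

variable {n : ℕ}

/-- The multiset of the positions of the units of a contingency matrix. -/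
def pts (M : CM n) : Multiset (ℕ × ℕ) :=
  ∑ i, ∑ j, M.mat.entry i j • {(i.1, j.1)}

theorem count_pts (M : CM n) (i : Fin M.rows) (j : Fin M.cols) :
    M.pts.count (i.1, j.1) = M.mat.entry i j := by
  unfold pts
  simp only [Multiset.count_sum', Multiset.count_nsmul]
  rw [Finset.sum_eq_single i, Finset.sum_eq_single j]
  · simp
  · intro b _ hb
    rw [Multiset.count_singleton, if_neg, mul_zero]
    simpa [Fin.ext_iff, eq_comm] using hb
  · simp
  · intro b _ hb
    refine Finset.sum_eq_zero fun c _ => ?_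
    rw [Multiset.count_singleton, if_neg, mul_zero]
    intro h
    exact hb (Fin.ext (Prod.ext_iff.1 h).1.symm)
  · simp

theorem mem_pts (M : CM n) {x : ℕ × ℕ} :
    x ∈ M.pts ↔ ∃ (i : Fin M.rows) (j : Fin M.cols), M.mat.entry i j ≠ 0 ∧ x = (i.1, j.1) := by
  unfold pts
  simp only [Multiset.mem_sum, Finset.mem_univ, true_and, Multiset.mem_nsmul,
    Multiset.mem_singleton]

theorem card_pts (M : CM n) : M.pts.card = n := by
  unfold pts
  simp only [Multiset.card_sum, Multiset.card_nsmul, Multiset.card_singleton, mul_one]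
  exact M.mat.weight

theorem mem_map_fst_pts (M : CM n) {a : ℕ} : a ∈ M.pts.map Prod.fst ↔ a < M.rows := by
  simp only [Multiset.mem_map, mem_pts]
  constructor
  · rintro ⟨_, ⟨i, j, -, rfl⟩, rfl⟩
    exact i.2
  · intro h
    obtain ⟨j, hj⟩ := M.mat.row_ne ⟨a, h⟩
    exact ⟨_, ⟨⟨a, h⟩, j, hj, rfl⟩, rfl⟩

theorem mem_map_snd_pts (M : CM n) {b : ℕ} : b ∈ M.pts.map Prod.snd ↔ b < M.cols := by
  simp only [Multiset.mem_map, mem_pts]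
  constructor
  · rintro ⟨_, ⟨i, j, -, rfl⟩, rfl⟩
    exact j.2
  · intro h
    obtain ⟨i, hi⟩ := M.mat.col_ne ⟨b, h⟩
    exact ⟨_, ⟨i, ⟨b, h⟩, hi, rfl⟩, rfl⟩

/-- No row or column is zero, so the projections of the points reveal the size; the entries are the
multiplicities. -/
theorem pts_injective : Function.Injective (pts (n := n)) := by
  intro M N h
  have hp : M.rows = N.rows := by
    have : ∀ a, a < M.rows ↔ a < N.rows := fun a => by
      rw [← mem_map_fst_pts, h, mem_map_fst_pts]
    have h1 := this M.rows
    have h2 := this N.rows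
    omega
  have hq : M.cols = N.cols := by
    have : ∀ a, a < M.cols ↔ a < N.cols := fun a => by
      rw [← mem_map_snd_pts, h, mem_map_snd_pts]
    have h1 := this M.cols
    have h2 := this N.cols
    omega
  obtain ⟨p, q, M⟩ := M
  obtain ⟨p', q', N⟩ := N
  dsimp only at hp hq
  subst hp hq
  congr 1
  ext i j
  exact (count_pts ⟨p, q, M⟩ i j).symm.trans ((congrArg _ h).trans (count_pts ⟨p, q, N⟩ i j))

/-- The map that identifies `i` and `i + 1` and shifts the larger numbers. -/
def shift (i a : ℕ) : ℕ := if a ≤ i then a else a - 1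

theorem monotone_shift (i : ℕ) : Monotone (shift i) := by
  intro a b h
  unfold shift
  split_ifs <;> omega

theorem val_predAbove {p : ℕ} (i : Fin p) (r : Fin (p + 1)) :
    (i.predAbove r).1 = shift i r := by
  unfold shift
  split_ifs with h
  · rw [Fin.predAbove_of_le_castSucc _ _ (by simpa [Fin.le_def] using h)]
    simp
  · rw [Fin.predAbove_of_castSucc_lt _ _ (by simpa [Fin.lt_def] using h)]
    simp

theorem pts_contractRow {p q : ℕ} (M : ContMat n (p + 1) q) (i : Fin p) :
    pts ⟨p, q, M.contractRow i⟩ = (pts ⟨p + 1, q, M⟩).map (Prod.map (shift i) id) := by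
  unfold pts
  simp only [ContMat.contractRow, Matrix.of_apply]
  rw [← Multiset.coe_mapAddMonoidHom, map_sum]
  simp only [map_sum, map_nsmul, Multiset.coe_mapAddMonoidHom, Multiset.map_singleton, Prod.map_apply,
    id_eq, Finset.sum_smul]
  rw [← Finset.sum_fiberwise Finset.univ i.predAbove]
  refine Finset.sum_congr rfl fun k _ => ?_
  rw [Finset.sum_comm]
  refine Finset.sum_congr rfl fun r hr => ?_
  refine Finset.sum_congr rfl fun j _ => ?_
  rw [← val_predAbove, (Finset.mem_filter.1 hr).2]

theorem pts_transpose {p q : ℕ} (M : ContMat n p q) :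
    pts ⟨q, p, M.transpose⟩ = (pts ⟨p, q, M⟩).map Prod.swap := by
  unfold pts
  rw [← Multiset.coe_mapAddMonoidHom, map_sum]
  simp only [map_sum, map_nsmul, Multiset.coe_mapAddMonoidHom, Multiset.map_singleton]
  exact Finset.sum_comm

theorem pts_contractCol {p q : ℕ} (M : ContMat n p (q + 1)) (j : Fin q) :
    pts ⟨p, q, M.contractCol j⟩ = (pts ⟨p, q + 1, M⟩).map (Prod.map id (shift j)) := by
  unfold ContMat.contractCol
  rw [pts_transpose, pts_contractRow, pts_transpose, Multiset.map_map, Multiset.map_map]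
  rfl

/-- With its converse `le_of_map` this replaces sequences of contractions by monotone changes of the
two coordinates. -/
theorem exists_map_of_le {M N : CM n} (h : M ≤ N) : ∃ f g : ℕ → ℕ, Monotone f ∧ Monotone g ∧
    N.pts = M.pts.map (Prod.map f g) := by
  induction h with
  | refl => exact ⟨id, id, monotone_id, monotone_id, by simp⟩
  | tail _ hs ih =>
    obtain ⟨f, g, hf, hg, h⟩ := ih
    cases hs with
    | row M i =>
      refine ⟨_, _, (monotone_shift i).comp hf, monotone_id.comp hg, ?_⟩
      rw [pts_contractRow, h, Multiset.map_map]
      rfl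
    | col M j =>
      refine ⟨_, _, monotone_id.comp hf, (monotone_shift j).comp hg, ?_⟩
      rw [pts_contractCol, h, Multiset.map_map]
      rfl

/-- A strictly monotone bijection between initial segments of `ℕ` is the identity. -/
theorem eq_self_of_injOn {p p' : ℕ} {f : ℕ → ℕ} (hf : Monotone f)
    (hinj : ∀ a, a + 1 < p → f a ≠ f (a + 1)) (hr : ∀ b, b < p' ↔ ∃ a < p, f a = b) :
    ∀ a < p, f a = a := by
  have hs : StrictMono fun a : Fin p => f a := by
    obtain _ | p := p
    · intro a
      exact a.elim0
    rw [Fin.strictMono_iff_lt_succ]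
    intro i
    exact lt_of_le_of_ne (hf (by simp)) (hinj i (by simp))
  have hcard : p = p' := by
    have hrange : Finset.univ.image (fun a : Fin p => f a) = Finset.range p' := by
      ext b
      simp only [Finset.mem_image, Finset.mem_univ, true_and, Finset.mem_range, hr]
      exact ⟨fun ⟨a, h⟩ => ⟨a, a.2, h⟩, fun ⟨a, h, h'⟩ => ⟨⟨a, h⟩, h'⟩⟩
    have := congrArg Finset.card hrange
    rwa [Finset.card_image_of_injective _ hs.injective, Finset.card_univ, Fintype.card_fin,
      Finset.card_range] at this
  subst hcard
  have : (fun a : Fin p => f a) = fun a => a.1 := by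
    refine (hs.range_inj Fin.val_strictMono).1 ?_
    ext b
    simp only [Set.mem_range]
    exact ⟨fun ⟨a, h⟩ => ⟨⟨b, (hr b).2 ⟨a, a.2, h⟩⟩, rfl⟩, fun ⟨a, h⟩ => by
      obtain ⟨c, hc, hc'⟩ := (hr b).1 (h ▸ a.2)
      exact ⟨⟨c, hc⟩, hc'⟩⟩
  exact fun a ha => congrFun this ⟨a, ha⟩

theorem exists_factor_shift {f : ℕ → ℕ} (hf : Monotone f) {i : ℕ} (hi : f i = f (i + 1)) :
    ∃ f' : ℕ → ℕ, Monotone f' ∧ f = f' ∘ shift i := by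
  refine ⟨fun b => if b ≤ i then f b else f (b + 1), ?_, ?_⟩
  · intro a b hab
    dsimp only
    split_ifs
    · exact hf hab
    · exact hf (by omega)
    · omega
    · exact hf (by omega)
  · funext a
    by_cases h1 : a ≤ i
    · simp [shift, h1]
    · have hsh : shift i a = a - 1 := if_neg h1
      simp only [Function.comp, hsh]
      by_cases h2 : a = i + 1
      · subst h2
        simp [hi]
      · rw [if_neg (by omega)]
        congr 1
        omega

/-- Induction on the size. If `f` or `g` identifies two adjacent indices, contract there and factor
the map through `shift`; otherwise both are the identity on the indices in use, and the matrices
coincide. -/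
theorem le_of_map {M N : CM n} {f g : ℕ → ℕ} (hf : Monotone f) (hg : Monotone g)
    (h : N.pts = M.pts.map (Prod.map f g)) : M ≤ N := by
  induction hs : M.rows + M.cols using Nat.strong_induction_on generalizing M f g with
  | _ s ih =>
  by_cases hfi : ∃ a, a + 1 < M.rows ∧ f a = f (a + 1)
  · obtain ⟨a, ha, hfa⟩ := hfi
    obtain ⟨f', hf', rfl⟩ := exists_factor_shift hf hfa
    obtain ⟨p, q, M⟩ := M
    obtain _ | p := p
    · simp at ha
    refine Relation.ReflTransGen.head (Step.row M ⟨a, by simpa using ha⟩) ?_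
    refine ih (p + q) (by simp only at hs; omega) hf' hg ?_ rfl
    rw [h, pts_contractRow, Multiset.map_map]
    rfl
  by_cases hgi : ∃ a, a + 1 < M.cols ∧ g a = g (a + 1)
  · obtain ⟨a, ha, hga⟩ := hgi
    obtain ⟨g', hg', rfl⟩ := exists_factor_shift hg hga
    obtain ⟨p, q, M⟩ := M
    obtain _ | q := q
    · simp at ha
    refine Relation.ReflTransGen.head (Step.col M ⟨a, by simpa using ha⟩) ?_
    refine ih (p + q) (by simp only at hs; omega) hf hg' ?_ rfl
    rw [h, pts_contractCol, Multiset.map_map]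
    rfl
  push Not at hfi hgi
  have h1 : ∀ a < M.rows, f a = a := by
    refine eq_self_of_injOn (p' := N.rows) hf hfi fun b => ?_
    rw [← mem_map_fst_pts, h, Multiset.map_map]
    have : Prod.fst ∘ Prod.map f g = f ∘ Prod.fst := rfl
    rw [this, ← Multiset.map_map, Multiset.mem_map]
    simp only [mem_map_fst_pts]
  have h2 : ∀ a < M.cols, g a = a := by
    refine eq_self_of_injOn (p' := N.cols) hg hgi fun b => ?_
    rw [← mem_map_snd_pts, h, Multiset.map_map]
    have : Prod.snd ∘ Prod.map f g = g ∘ Prod.snd := rfl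
    rw [this, ← Multiset.map_map, Multiset.mem_map]
    simp only [mem_map_snd_pts]
  refine le_of_eq (pts_injective ?_)
  rw [h]
  conv_lhs => rw [← Multiset.map_id M.pts]
  refine Multiset.map_congr rfl fun x hx => ?_
  obtain ⟨i, j, -, rfl⟩ := M.mem_pts.1 hx
  simp [h1 i i.2, h2 j j.2]

end CM

/-! ### Contingency matrices in terms of jump sets and permutations -/

section Conf

variable {α β γ δ : Type} {n : ℕ}

/-- The multiset of the pairs `(x k, y (τ k))`. -/
def conf (x : Fin n → α) (τ : Equiv.Perm (Fin n)) (y : Fin n → β) : Multiset (α × β) :=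
  Finset.univ.val.map fun k => (x k, y (τ k))

theorem conf_map (x : Fin n → α) (τ : Equiv.Perm (Fin n)) (y : Fin n → β) (f : α → γ)
    (g : β → δ) : (conf x τ y).map (Prod.map f g) = conf (f ∘ x) τ (g ∘ y) := by
  unfold conf
  rw [Multiset.map_map]
  rfl

theorem map_fst_conf (x : Fin n → α) (τ : Equiv.Perm (Fin n)) (y : Fin n → β) :
    (conf x τ y).map Prod.fst = Finset.univ.val.map x := by
  unfold conf
  rw [Multiset.map_map]
  rfl

theorem map_univ_comp_perm (τ : Equiv.Perm (Fin n)) (y : Fin n → β) :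
    (Finset.univ.val.map fun k => y (τ k)) = Finset.univ.val.map y := by
  have : (Finset.univ : Finset (Fin n)).val.map τ = Finset.univ.val := by
    have := congrArg Finset.val (Finset.map_univ_equiv τ)
    rwa [Finset.map_val] at this
  conv_rhs => rw [← this, Multiset.map_map]
  rfl

theorem map_snd_conf (x : Fin n → α) (τ : Equiv.Perm (Fin n)) (y : Fin n → β) :
    (conf x τ y).map Prod.snd = Finset.univ.val.map y := by
  unfold conf
  rw [Multiset.map_map]
  exact map_univ_comp_perm τ y

theorem eq_of_monotone_of_map_eq [PartialOrder α] {x x' : Fin n → α} (hx : Monotone x)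
    (hx' : Monotone x')
    (h : (Finset.univ : Finset (Fin n)).val.map x = Finset.univ.val.map x') : x = x' := by
  rw [Fin.univ_val_map, Fin.univ_val_map, Multiset.coe_eq_coe] at h
  exact List.ofFn_injective (h.eq_of_sortedLE hx.sortedLE_ofFn hx'.sortedLE_ofFn)

theorem exists_map_univ_eq {S : Multiset α} (hS : S.card = n) :
    ∃ L : Fin n → α, S = Finset.univ.val.map L := by
  subst hS
  induction S using Quotient.inductionOn with
  | _ l =>
    refine ⟨l.get, ?_⟩
    refine Eq.trans ?_ (Fin.univ_val_map l.get).symm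
    rw [List.ofFn_get]
    rfl

/-- Each finite configuration of points in a product of linear orders can be sorted. -/
theorem exists_conf_eq [LinearOrder α] [LinearOrder β] {S : Multiset (α × β)} (hS : S.card = n) :
    ∃ (x : Fin n → α) (τ : Equiv.Perm (Fin n)) (y : Fin n → β), Monotone x ∧ Monotone y ∧
      S = conf x τ y := by
  obtain ⟨L, rfl⟩ := exists_map_univ_eq hS
  let f := fun k => (L k).1
  let g := fun k => (L k).2
  -- The permutation sends the place of a point in the order of first coordinates to its place in
  -- the order of second coordinates.
  refine ⟨f ∘ Tuple.sort f, (Tuple.sort f).trans (Tuple.sort g).symm, g ∘ Tuple.sort g,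
    Tuple.monotone_sort f, Tuple.monotone_sort g, ?_⟩
  rw [← map_univ_comp_perm (Tuple.sort f)]
  simp [conf, f, g]

/-- The primed sequences are functions of the unprimed ones, so the primed configurations are images
of the unprimed ones under one and the same map. -/
theorem conf_eq_of_factor {x : Fin n → α} {y : Fin n → β} {x' : Fin n → γ} {y' : Fin n → δ}
    {τ τ' : Equiv.Perm (Fin n)} (hx : ∀ k l, x k = x l → x' k = x' l)
    (hy : ∀ k l, y k = y l → y' k = y' l) (h : conf x τ y = conf x τ' y) :
    conf x' τ y' = conf x' τ' y' := by
  -- The extensions below need a default value off the range, for which `x' 0` and `y' 0` serve;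
  -- hence the empty case is treated apart.
  obtain _ | n := n
  · rw [Subsingleton.elim τ τ']
  have hx' : x' = Function.extend x x' (fun _ => x' 0) ∘ x :=
    (Function.FactorsThrough.extend_comp (f := x) (g := x') _ fun k l h => hx k l h).symm
  have hy' : y' = Function.extend y y' (fun _ => y' 0) ∘ y :=
    (Function.FactorsThrough.extend_comp (f := y) (g := y') _ fun k l h => hy k l h).symm
  rw [hx', hy', ← conf_map, h, conf_map]

end Conf

section Rank

variable {m : ℕ}

/-- The number of elements of `A` below `k`: the monotone function that starts at `0` and jumps by
one at the elements of `A`. -/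
def rk (A : Finset (Fin m)) (k : Fin (m + 1)) : ℕ := (A.filter fun l => l.castSucc < k).card

theorem monotone_rk (A : Finset (Fin m)) : Monotone (rk A) := fun _ _ h =>
  Finset.card_le_card (Finset.monotone_filter_right A fun _ _ hl => lt_of_lt_of_le hl h)

theorem rk_zero (A : Finset (Fin m)) : rk A 0 = 0 := by
  simp [rk]

theorem rk_last (A : Finset (Fin m)) : rk A (Fin.last m) = A.card := by
  simp [rk, Fin.castSucc_lt_last]

theorem rk_succ (A : Finset (Fin m)) (l : Fin m) :
    rk A l.succ = rk A l.castSucc + if l ∈ A then 1 else 0 := by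
  have h1 : ∀ k : Fin m, k.castSucc < l.succ ↔ (k.castSucc < l.castSucc ∨ k = l) := by
    intro k
    simp only [Fin.lt_def, Fin.ext_iff, Fin.val_castSucc, Fin.val_succ]
    omega
  unfold rk
  simp only [h1]
  rw [Finset.filter_or, Finset.card_union_of_disjoint, Finset.filter_eq' A l]
  · split_ifs <;> simp
  · rw [Finset.disjoint_filter]
    rintro k - h rfl
    exact lt_irrefl _ h

theorem rk_castSucc_lt_succ (A : Finset (Fin m)) (l : Fin m) :
    rk A l.castSucc < rk A l.succ ↔ l ∈ A := by
  rw [rk_succ]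
  split_ifs with h <;> simp [h]

theorem rk_injective : Function.Injective (rk (m := m)) := by
  intro A B h
  ext l
  rw [← rk_castSucc_lt_succ, h, rk_castSucc_lt_succ]

theorem exists_rk_eq (A : Finset (Fin m)) {v : ℕ} : (∃ k, rk A k = v) ↔ v < A.card + 1 := by
  constructor
  · rintro ⟨k, rfl⟩
    have := monotone_rk A (Fin.le_last k)
    rw [rk_last] at this
    omega
  · intro hv
    have key : ∀ k : Fin (m + 1), ∀ v ≤ rk A k, ∃ k, rk A k = v := by
      intro k
      induction k using Fin.induction with
      | zero =>
        intro v hv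
        rw [rk_zero] at hv
        exact ⟨0, by rw [rk_zero]; omega⟩
      | succ l ih =>
        intro v hv
        rcases Nat.lt_or_ge (rk A l.castSucc) v with h | h
        · refine ⟨l.succ, ?_⟩
          rw [rk_succ] at hv ⊢
          split_ifs at hv ⊢ <;> omega
        · exact ih v h
    exact key (Fin.last m) v (by rw [rk_last]; omega)

/-- A monotone sequence that takes exactly the values of an initial segment starts at `0` and rises
by at most one at a time, so its jumps determine it. -/
theorem eq_rk_of_monotone {x : Fin (m + 1) → ℕ} (hx : Monotone x) {p : ℕ}
    (hp : ∀ v, v < p ↔ ∃ k, x k = v) :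
    x = rk (Finset.univ.filter fun l : Fin m => x l.castSucc < x l.succ) := by
  funext k
  induction k using Fin.induction with
  | zero =>
    rw [rk_zero]
    have h0 : 0 < p := lt_of_le_of_lt (Nat.zero_le _) ((hp (x 0)).2 ⟨0, rfl⟩)
    obtain ⟨k, hk⟩ := (hp 0).1 h0
    have := hx (Fin.zero_le k)
    omega
  | succ l ih =>
    rw [rk_succ, ← ih]
    simp only [Finset.mem_filter, Finset.mem_univ, true_and]
    have hle : x l.castSucc ≤ x l.succ := hx (Fin.castSucc_lt_succ).le
    have hstep : x l.succ ≤ x l.castSucc + 1 := by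
      by_contra! hlt
      obtain ⟨k, hk⟩ := (hp (x l.castSucc + 1)).1 (hlt.trans ((hp _).2 ⟨_, rfl⟩))
      rcases le_or_gt k l.castSucc with h | h
      · have := hx h
        omega
      · have := hx (Fin.castSucc_lt_iff_succ_le.1 h)
        omega
    split_ifs <;> omega

/-- A function that is constant across the non-jumps is a function of the rank. -/
theorem eq_of_rk_eq {α : Type} {A : Finset (Fin m)} {d : Fin (m + 1) → α}
    (hd : ∀ l ∉ A, d l.castSucc = d l.succ) {k k' : Fin (m + 1)} (h : rk A k = rk A k') :
    d k = d k' := by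
  have key : ∀ k' k : Fin (m + 1), k ≤ k' → rk A k = rk A k' → d k = d k' := by
    intro k'
    induction k' using Fin.induction with
    | zero =>
      intro k hk _
      rw [Fin.le_zero_iff.1 hk]
    | succ l ih =>
      intro k hk h
      rcases hk.eq_or_lt with rfl | hlt
      · rfl
      have hk' : k ≤ l.castSucc := Fin.le_castSucc_iff.2 hlt
      have h1 := monotone_rk A hk'
      have h2 := rk_succ A l
      have hl : l ∉ A := by
        intro hl
        rw [if_pos hl] at h2
        omega
      rw [if_neg hl] at h2
      rw [ih k hk' (by omega), hd l hl]
  rcases le_total k k' with hk | hk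
  · exact key _ _ hk h
  · exact (key _ _ hk h.symm).symm

/-- For `l ∈ A' ⊆ A`, lying before `k` is the same as having smaller `A`-rank than `k`, so the count
defining `rk A'` depends on `rk A k` only. -/
theorem exists_monotone_comp_rk {A A' : Finset (Fin m)} (hA : A' ⊆ A) :
    ∃ f : ℕ → ℕ, Monotone f ∧ rk A' = f ∘ rk A := by
  refine ⟨fun v => (A'.filter fun l => rk A l.castSucc < v).card, fun v w h =>
    Finset.card_le_card (Finset.monotone_filter_right _ fun _ _ hl => lt_of_lt_of_le hl h), ?_⟩
  funext k
  simp only [rk, Function.comp]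
  congr 1
  refine Finset.filter_congr fun l hl => ?_
  constructor
  · intro h
    have h1 := (rk_castSucc_lt_succ A l).2 (hA hl)
    exact lt_of_lt_of_le h1 (monotone_rk A (Fin.castSucc_lt_iff_succ_le.1 h))
  · intro h
    by_contra! h'
    exact absurd h (not_lt.2 (monotone_rk A h'))

end Rank

namespace CM

variable {m : ℕ}

/-- The contingency matrix of the configuration of the points `(rk A k, rk B (τ k))`. -/
def ofJumps (A B : Finset (Fin m)) (τ : Equiv.Perm (Fin (m + 1))) : CM (m + 1) where
  rows := A.card + 1
  cols := B.card + 1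
  mat :=
    { entry := Matrix.of fun i j =>
        (Finset.univ.filter fun k => rk A k = i ∧ rk B (τ k) = j).card
      row_ne := by
        intro i
        obtain ⟨k, hk⟩ := (exists_rk_eq A).2 i.2
        refine ⟨⟨rk B (τ k), (exists_rk_eq B).1 ⟨_, rfl⟩⟩, ?_⟩
        rw [Matrix.of_apply, Finset.card_ne_zero]
        exact ⟨k, by simp [hk]⟩
      col_ne := by
        intro j
        obtain ⟨k, hk⟩ := (exists_rk_eq B).2 j.2
        refine ⟨⟨rk A (τ.symm k), (exists_rk_eq A).1 ⟨_, rfl⟩⟩, ?_⟩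
        rw [Matrix.of_apply, Finset.card_ne_zero]
        exact ⟨τ.symm k, by simp [hk]⟩
      weight := by
        simp only [Matrix.of_apply]
        have h := Finset.card_eq_sum_card_fiberwise (s := (Finset.univ : Finset (Fin (m + 1))))
          (t := (Finset.univ : Finset (Fin (A.card + 1) × Fin (B.card + 1))))
          (f := fun k => (⟨rk A k, (exists_rk_eq A).1 ⟨_, rfl⟩⟩,
            ⟨rk B (τ k), (exists_rk_eq B).1 ⟨_, rfl⟩⟩)) (by simp [Set.MapsTo])
        rw [Finset.card_univ, Fintype.card_fin, ← Finset.univ_product_univ,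
          Finset.sum_product] at h
        refine Eq.trans ?_ h.symm
        refine Finset.sum_congr rfl fun i _ => Finset.sum_congr rfl fun j _ => ?_
        simp only [Prod.ext_iff, Fin.ext_iff] }

theorem pts_ofJumps (A B : Finset (Fin m)) (τ : Equiv.Perm (Fin (m + 1))) :
    (ofJumps A B τ).pts = conf (rk A) τ (rk B) := by
  ext ⟨a, b⟩
  by_cases h : a < A.card + 1 ∧ b < B.card + 1
  · refine (count_pts (ofJumps A B τ) ⟨a, h.1⟩ ⟨b, h.2⟩).trans ?_
    unfold conf
    rw [Multiset.count_map]
    change (Finset.univ.filter fun k => rk A k = a ∧ rk B (τ k) = b).card = _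
    rw [Finset.card_def, Finset.filter_val]
    simp only [Prod.ext_iff, eq_comm]
  · rw [Multiset.count_eq_zero_of_notMem, Multiset.count_eq_zero_of_notMem]
    · unfold conf
      rw [Multiset.mem_map]
      rintro ⟨k, -, hk⟩
      rw [Prod.ext_iff] at hk
      exact h ⟨(exists_rk_eq A).1 ⟨k, hk.1⟩, (exists_rk_eq B).1 ⟨τ k, hk.2⟩⟩
    · rw [mem_pts]
      rintro ⟨i, j, -, hij⟩
      rw [Prod.ext_iff] at hij
      exact h ⟨lt_of_eq_of_lt hij.1 i.2, lt_of_eq_of_lt hij.2 j.2⟩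

/-- Sort the points of `M` in both directions; the sorted coordinates fill initial segments, so they
are rank functions. -/
theorem exists_eq_ofJumps (M : CM (m + 1)) : ∃ A B τ, M = ofJumps A B τ := by
  obtain ⟨x, τ, y, hx, hy, h⟩ := exists_conf_eq M.card_pts
  refine ⟨Finset.univ.filter fun l : Fin m => x l.castSucc < x l.succ,
    Finset.univ.filter fun l : Fin m => y l.castSucc < y l.succ, τ, pts_injective ?_⟩
  rw [pts_ofJumps, ← eq_rk_of_monotone hx (p := M.rows), ← eq_rk_of_monotone hy (p := M.cols), h]
  · intro v
    rw [← mem_map_snd_pts, h, map_snd_conf, Multiset.mem_map]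
    simp
  · intro v
    rw [← mem_map_fst_pts, h, map_fst_conf, Multiset.mem_map]
    simp

theorem ofJumps_eq_iff {A B A' B' : Finset (Fin m)} {τ τ' : Equiv.Perm (Fin (m + 1))} :
    ofJumps A B τ = ofJumps A' B' τ' ↔ conf (rk A) τ (rk B) = conf (rk A') τ' (rk B') := by
  rw [← pts_injective.eq_iff, pts_ofJumps, pts_ofJumps]

/-- The jump sets are invariants of the matrix. The permutation is not: points in the same block may
be exchanged. -/
theorem eq_of_ofJumps_eq {A B A' B' : Finset (Fin m)} {τ τ' : Equiv.Perm (Fin (m + 1))}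
    (h : ofJumps A B τ = ofJumps A' B' τ') : A = A' ∧ B = B' := by
  rw [ofJumps_eq_iff] at h
  constructor
  · have := congrArg (Multiset.map Prod.fst) h
    rw [map_fst_conf, map_fst_conf] at this
    exact rk_injective (eq_of_monotone_of_map_eq (monotone_rk _) (monotone_rk _) this)
  · have := congrArg (Multiset.map Prod.snd) h
    rw [map_snd_conf, map_snd_conf] at this
    exact rk_injective (eq_of_monotone_of_map_eq (monotone_rk _) (monotone_rk _) this)

theorem ofJumps_le_ofJumps {A B A' B' : Finset (Fin m)} (hA : A' ⊆ A) (hB : B' ⊆ B)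
    (τ : Equiv.Perm (Fin (m + 1))) : ofJumps A B τ ≤ ofJumps A' B' τ := by
  obtain ⟨f, hf, hf'⟩ := exists_monotone_comp_rk hA
  obtain ⟨g, hg, hg'⟩ := exists_monotone_comp_rk hB
  refine le_of_map hf hg ?_
  rw [pts_ofJumps, pts_ofJumps, conf_map, hf', hg']

/-- The jump set of the rows: the partial sums of the row sums. -/
noncomputable def rowJumps (M : CM (m + 1)) : Finset (Fin m) := (exists_eq_ofJumps M).choose

/-- The jump set of the columns: the partial sums of the column sums. -/
noncomputable def colJumps (M : CM (m + 1)) : Finset (Fin m) :=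
  (exists_eq_ofJumps M).choose_spec.choose

/-- `Sorts M τ`: the permutation `τ` describes the relative position of the points of `M` in the
two directions. -/
def Sorts (M : CM (m + 1)) (τ : Equiv.Perm (Fin (m + 1))) : Prop :=
  M = ofJumps M.rowJumps M.colJumps τ

theorem exists_sorts (M : CM (m + 1)) : ∃ τ, M.Sorts τ :=
  (exists_eq_ofJumps M).choose_spec.choose_spec

theorem rowJumps_ofJumps (A B : Finset (Fin m)) (τ : Equiv.Perm (Fin (m + 1))) :
    (ofJumps A B τ).rowJumps = A := by
  obtain ⟨τ', h⟩ := (ofJumps A B τ).exists_sorts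
  exact (eq_of_ofJumps_eq h).1.symm

theorem colJumps_ofJumps (A B : Finset (Fin m)) (τ : Equiv.Perm (Fin (m + 1))) :
    (ofJumps A B τ).colJumps = B := by
  obtain ⟨τ', h⟩ := (ofJumps A B τ).exists_sorts
  exact (eq_of_ofJumps_eq h).2.symm

theorem sorts_ofJumps (A B : Finset (Fin m)) (τ : Equiv.Perm (Fin (m + 1))) :
    (ofJumps A B τ).Sorts τ := by
  rw [Sorts, rowJumps_ofJumps, colJumps_ofJumps]

theorem Sorts.pts_eq {M : CM (m + 1)} {τ : Equiv.Perm (Fin (m + 1))} (h : M.Sorts τ) :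
    M.pts = conf (rk M.rowJumps) τ (rk M.colJumps) := by
  conv_lhs => rw [h, pts_ofJumps]

/-- Monotone maps keep sorted sequences sorted, so the ranks for `N` are `f` and `g` of the ranks
for `M`. Passing to a larger matrix therefore only removes jumps and keeps every sorting
permutation. -/
theorem rowJumps_colJumps_sorts_of_le {M N : CM (m + 1)} (hMN : M ≤ N) :
    N.rowJumps ⊆ M.rowJumps ∧ N.colJumps ⊆ M.colJumps ∧ ∀ τ, M.Sorts τ → N.Sorts τ := by
  obtain ⟨f, g, hf, hg, h⟩ := exists_map_of_le hMN
  obtain ⟨τ', hτ'⟩ := N.exists_sorts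
  have key : ∀ τ, M.Sorts τ → rk N.rowJumps = f ∘ rk M.rowJumps ∧
      rk N.colJumps = g ∘ rk M.colJumps := by
    intro τ hτ
    rw [hτ.pts_eq, hτ'.pts_eq, conf_map] at h
    constructor
    · have := congrArg (Multiset.map Prod.fst) h
      rw [map_fst_conf, map_fst_conf] at this
      exact eq_of_monotone_of_map_eq (monotone_rk _) (hf.comp (monotone_rk _)) this
    · have := congrArg (Multiset.map Prod.snd) h
      rw [map_snd_conf, map_snd_conf] at this
      exact eq_of_monotone_of_map_eq (monotone_rk _) (hg.comp (monotone_rk _)) this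
  obtain ⟨τ₀, hτ₀⟩ := M.exists_sorts
  have hsub : ∀ {A B : Finset (Fin m)} {f : ℕ → ℕ}, rk A = f ∘ rk B → A ⊆ B := by
    intro A B f h l hl
    rw [← rk_castSucc_lt_succ] at hl ⊢
    refine lt_of_le_of_ne (monotone_rk B (Fin.castSucc_lt_succ).le) fun heq => hl.ne ?_
    rw [h, Function.comp, Function.comp, heq]
  refine ⟨hsub (key τ₀ hτ₀).1, hsub (key τ₀ hτ₀).2, fun τ hτ => pts_injective ?_⟩
  rw [pts_ofJumps, (key τ hτ).1, (key τ hτ).2, ← conf_map, ← hτ.pts_eq, h]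

instance : Finite (CM (m + 1)) := by
  refine Finite.of_surjective
    (fun a : Finset (Fin m) × Finset (Fin m) × Equiv.Perm (Fin (m + 1)) =>
      ofJumps a.1 a.2.1 a.2.2) fun M => ?_
  obtain ⟨A, B, τ, h⟩ := exists_eq_ofJumps M
  exact ⟨(A, B, τ), h.symm⟩

end CM

/-! ### Centred sequences -/

section Centred

variable {m : ℕ}

/-- The sum of `x` over each block of the jump set `A` vanishes. -/
def Centred (A : Finset (Fin m)) (x : Fin (m + 1) → ℝ) : Prop :=
  ∀ i : ℕ, ∑ k with rk A k = i, x k = 0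

/-- Subtract from `z` its average over each block of the jump set `A`. -/
noncomputable def centre (A : Finset (Fin m)) (z : Fin (m + 1) → ℝ) (k : Fin (m + 1)) : ℝ :=
  z k - (∑ k' with rk A k' = rk A k, z k') / (Finset.univ.filter fun k' => rk A k' = rk A k).card

theorem centred_centre (A : Finset (Fin m)) (z : Fin (m + 1) → ℝ) : Centred A (centre A z) := by
  intro i
  unfold centre
  rw [Finset.sum_sub_distrib, sub_eq_zero]
  rcases (Finset.univ.filter fun k => rk A k = i).eq_empty_or_nonempty with h | h
  · simp [h]
  have : ∀ k ∈ Finset.univ.filter fun k => rk A k = i,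
      (∑ k' with rk A k' = rk A k, z k') / (Finset.univ.filter fun k' => rk A k' = rk A k).card =
      (∑ k' with rk A k' = i, z k') / (Finset.univ.filter fun k' => rk A k' = i).card := by
    intro k hk
    rw [(Finset.mem_filter.1 hk).2]
  rw [Finset.sum_congr rfl this, Finset.sum_const, nsmul_eq_mul, mul_div_cancel₀]
  exact_mod_cast (Finset.card_pos.2 h).ne'

theorem centre_sub (A : Finset (Fin m)) (z : Fin (m + 1) → ℝ) {l : Fin m} (hl : l ∉ A) :
    centre A z l.succ - centre A z l.castSucc = z l.succ - z l.castSucc := by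
  unfold centre
  rw [rk_succ, if_neg hl, add_zero]
  ring

/-- Equal increments inside the blocks make the difference constant on each block, and centring
makes that constant zero. -/
theorem Centred.ext {A : Finset (Fin m)} {x y : Fin (m + 1) → ℝ} (hx : Centred A x)
    (hy : Centred A y)
    (h : ∀ l ∉ A, x l.succ - x l.castSucc = y l.succ - y l.castSucc) : x = y := by
  funext k
  have hconst : ∀ k' ∈ Finset.univ.filter fun k' => rk A k' = rk A k,
      x k' - y k' = x k - y k := by
    intro k' hk'
    refine eq_of_rk_eq (A := A) (d := fun k => x k - y k) (fun l hl => ?_)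
      (Finset.mem_filter.1 hk').2
    have := h l hl
    linarith
  have hsum : ∑ k' with rk A k' = rk A k, (x k' - y k') = 0 := by
    rw [Finset.sum_sub_distrib, hx, hy, sub_zero]
  rw [Finset.sum_congr rfl hconst, Finset.sum_const, nsmul_eq_mul, mul_eq_zero] at hsum
  rcases hsum with h0 | h0
  · have : 0 < (Finset.univ.filter fun k' => rk A k' = rk A k).card :=
      Finset.card_pos.2 ⟨k, by simp⟩
    exact absurd h0 (by exact_mod_cast this.ne')
  · exact sub_eq_zero.1 h0

/-- The sequence `x` together with the block labels. -/
def key (A : Finset (Fin m)) (x : Fin (m + 1) → ℝ) (k : Fin (m + 1)) : ℕ ×ₗ ℝ :=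
  toLex (rk A k, x k)

theorem monotone_key {A : Finset (Fin m)} {x : Fin (m + 1) → ℝ}
    (hx : ∀ l ∉ A, x l.castSucc ≤ x l.succ) : Monotone (key A x) := by
  rw [Fin.monotone_iff_le_succ]
  intro l
  unfold key
  rw [Prod.Lex.toLex_le_toLex]
  by_cases hl : l ∈ A
  · exact Or.inl ((rk_castSucc_lt_succ A l).2 hl)
  · refine Or.inr ⟨?_, hx l hl⟩
    rw [rk_succ, if_neg hl, add_zero]

theorem le_succ_of_monotone_key {A : Finset (Fin m)} {x : Fin (m + 1) → ℝ}
    (hx : Monotone (key A x)) {l : Fin m} (hl : l ∉ A) : x l.castSucc ≤ x l.succ := by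
  have h := hx (Fin.castSucc_lt_succ (i := l)).le
  unfold key at h
  rw [Prod.Lex.toLex_le_toLex] at h
  rcases h with h | h
  · exact absurd ((rk_castSucc_lt_succ A l).1 h) hl
  · exact h.2

theorem key_injective (A : Finset (Fin m)) : Function.Injective (key A) := by
  intro x y h
  funext k
  exact (Prod.ext_iff.1 (toLex.injective (congrFun h k))).2

/-- A monotone `w` with equal values at two places is constant between them, so no element of `C`
lies between them. -/
theorem rk_eq_of_eq {α : Type} [PartialOrder α] {C : Finset (Fin m)} {w : Fin (m + 1) → α}
    (hw : Monotone w) (hC : ∀ l ∈ C, w l.castSucc ≠ w l.succ) {k k' : Fin (m + 1)}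
    (h : w k = w k') : rk C k = rk C k' := by
  have H : ∀ k' k : Fin (m + 1), k ≤ k' → w k = w k' → rk C k = rk C k' := by
    intro k'
    induction k' using Fin.induction with
    | zero =>
      intro k hk _
      rw [Fin.le_zero_iff.1 hk]
    | succ l ih =>
      intro k hk h
      rcases hk.eq_or_lt with rfl | hlt
      · rfl
      have hk' : k ≤ l.castSucc := Fin.le_castSucc_iff.2 hlt
      have h1 : w l.castSucc = w l.succ :=
        le_antisymm (hw (Fin.castSucc_lt_succ).le) (h ▸ hw hk')
      have hl : l ∉ C := fun hl => hC l hl h1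
      rw [ih k hk' (h.trans h1.symm), rk_succ, if_neg hl, add_zero]
  rcases le_total k k' with hk | hk
  · exact H _ _ hk h
  · exact (H _ _ hk h.symm).symm

end Centred

/-! ### Positions and gaps of a weighted chain -/

namespace CM

variable {m : ℕ}

noncomputable instance : Fintype (CM (m + 1)) := Fintype.ofFinite _

open PosetNerve

/-- The total weight of the matrices with a jump at `l`. -/
noncomputable def gap (J : CM (m + 1) → Finset (Fin m)) (t : CM (m + 1) → ℝ) (l : Fin m) : ℝ :=
  ∑ N, if l ∈ J N then t N else 0

/-- The weighted average of the positions of the points, centred with respect to `A`. -/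
noncomputable def pos (J : CM (m + 1) → Finset (Fin m)) (A : Finset (Fin m))
    (t : CM (m + 1) → ℝ) : Fin (m + 1) → ℝ :=
  centre A fun k => ∑ N, t N * rk (J N) k

/-- Centring does not change increments inside a block, and the rank for `N` rises by one at `l`
exactly when `l ∈ J N`. -/
theorem pos_sub (J : CM (m + 1) → Finset (Fin m)) (A : Finset (Fin m)) (t : CM (m + 1) → ℝ)
    {l : Fin m} (hl : l ∉ A) : pos J A t l.succ - pos J A t l.castSucc = gap J t l := by
  unfold pos gap
  rw [centre_sub _ _ hl, ← Finset.sum_sub_distrib]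
  refine Finset.sum_congr rfl fun N _ => ?_
  rw [rk_succ]
  split_ifs <;> push_cast <;> ring

theorem gap_nonneg (J : CM (m + 1) → Finset (Fin m)) {t : CM (m + 1) → ℝ} (ht : ∀ N, 0 ≤ t N)
    (l : Fin m) : 0 ≤ gap J t l :=
  Finset.sum_nonneg fun N _ => by split_ifs; exacts [ht N, le_rfl]

theorem gap_le_sum (J : CM (m + 1) → Finset (Fin m)) {t : CM (m + 1) → ℝ} (ht : ∀ N, 0 ≤ t N)
    (l : Fin m) : gap J t l ≤ ∑ N, t N :=
  Finset.sum_le_sum fun N _ => by split_ifs; exacts [le_rfl, ht N]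

theorem monotone_key_pos (J : CM (m + 1) → Finset (Fin m)) (A : Finset (Fin m))
    {t : CM (m + 1) → ℝ} (ht : ∀ N, 0 ≤ t N) : Monotone (key A (pos J A t)) := by
  refine monotone_key fun l hl => ?_
  have h1 := pos_sub J A t hl
  have h2 := gap_nonneg J ht l
  linarith

theorem antitone_rowJumps {M N : CM (m + 1)} (h : M ≤ N) : N.rowJumps ⊆ M.rowJumps :=
  (rowJumps_colJumps_sorts_of_le h).1

theorem antitone_colJumps {M N : CM (m + 1)} (h : M ≤ N) : N.colJumps ⊆ M.colJumps :=
  (rowJumps_colJumps_sorts_of_le h).2.1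

theorem Sorts.of_le {M N : CM (m + 1)} {τ : Equiv.Perm (Fin (m + 1))} (hτ : M.Sorts τ)
    (h : M ≤ N) : N.Sorts τ :=
  (rowJumps_colJumps_sorts_of_le h).2.2 τ hτ

/-- The permutation `τ` sorts `M` and the matrices in the support of `t`. -/
def Adapted (M : CM (m + 1)) (t : CM (m + 1) → ℝ) (τ : Equiv.Perm (Fin (m + 1))) : Prop :=
  M.Sorts τ ∧ ∀ N, t N ≠ 0 → N.Sorts τ

/-- The least matrix of the support is the finest: it has the largest jump sets, and whatever sorts
it sorts the whole chain. For `t = 0` its role is played by `M`. -/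
theorem exists_least {M : CM (m + 1)} {t : CM (m + 1) → ℝ} (ht : t ∈ chainCone M) :
    ∃ N₀, N₀ ≤ M ∧ (∀ N, t N ≠ 0 → N₀ ≤ N) ∧ (t N₀ ≠ 0 ∨ N₀ = M) := by
  rcases (Function.support t).eq_empty_or_nonempty with h | h
  · refine ⟨M, le_rfl, fun N hN => ?_, Or.inr rfl⟩
    have : N ∈ Function.support t := hN
    rw [h] at this
    exact absurd this (Set.notMem_empty N)
  · obtain ⟨N₀, hN₀⟩ := (Set.toFinite (Function.support t)).exists_minimal h
    refine ⟨N₀, (ht.2.2 hN₀.1).le, fun N hN => ?_, Or.inl hN₀.1⟩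
    rcases ht.2.1.total hN₀.1 hN with h | h
    exacts [h, hN₀.2 hN h]

theorem mem_jumps_least {M N₀ : CM (m + 1)} {t : CM (m + 1) → ℝ} (ht : ∀ N, 0 ≤ t N)
    {J : CM (m + 1) → Finset (Fin m)} (hJ : ∀ {M N}, M ≤ N → J N ⊆ J M) (hM : N₀ ≤ M)
    (hle : ∀ N, t N ≠ 0 → N₀ ≤ N) (hor : t N₀ ≠ 0 ∨ N₀ = M) {l : Fin m} :
    l ∈ J N₀ ↔ l ∈ J M ∨ gap J t l ≠ 0 := by
  constructor
  · intro hl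
    rcases hor with h | rfl
    · refine Or.inr (ne_of_gt (lt_of_lt_of_le (lt_of_le_of_ne (ht N₀) h.symm) ?_))
      unfold gap
      refine le_trans (by rw [if_pos hl]) (Finset.single_le_sum
        (f := fun N => if l ∈ J N then t N else 0) (fun N _ => ?_) (Finset.mem_univ N₀))
      split_ifs
      exacts [ht N, le_rfl]
    · exact Or.inl hl
  · rintro (h | h)
    · exact hJ hM h
    · unfold gap at h
      obtain ⟨N, -, hN⟩ := Finset.exists_ne_zero_of_sum_ne_zero h
      rw [ne_eq, ite_eq_right_iff, not_forall] at hN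
      obtain ⟨hlN, hN⟩ := hN
      exact hJ (hle N hN) hlN

theorem Adapted.of_least {M N₀ : CM (m + 1)} {t : CM (m + 1) → ℝ} (hM : N₀ ≤ M)
    (hle : ∀ N, t N ≠ 0 → N₀ ≤ N) {τ : Equiv.Perm (Fin (m + 1))} (hτ : N₀.Sorts τ) :
    M.Adapted t τ :=
  ⟨hτ.of_le hM, fun N hN => hτ.of_le (hle N hN)⟩

theorem exists_adapted {M : CM (m + 1)} {t : CM (m + 1) → ℝ} (ht : t ∈ chainCone M) :
    ∃ τ, M.Adapted t τ := by
  obtain ⟨N₀, hM, hle, -⟩ := exists_least ht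
  obtain ⟨τ, hτ⟩ := N₀.exists_sorts
  exact ⟨τ, Adapted.of_least hM hle hτ⟩

/-- The configuration of labelled points described by a weighted chain. -/
noncomputable def keyConf (M : CM (m + 1)) (t : CM (m + 1) → ℝ) (τ : Equiv.Perm (Fin (m + 1))) :
    Multiset ((ℕ ×ₗ ℝ) × (ℕ ×ₗ ℝ)) :=
  conf (key M.rowJumps (pos rowJumps M.rowJumps t)) τ (key M.colJumps (pos colJumps M.colJumps t))

/-- The rows (or columns) of the least matrix are exactly the classes of indices with equal label
and equal position, since its jumps are those of `M` together with the non-zero gaps. -/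
theorem key_pos_eq {M N₀ : CM (m + 1)} {t : CM (m + 1) → ℝ} (ht : ∀ N, 0 ≤ t N)
    {J : CM (m + 1) → Finset (Fin m)} (hJ : ∀ {M N}, M ≤ N → J N ⊆ J M) (hM : N₀ ≤ M)
    (hle : ∀ N, t N ≠ 0 → N₀ ≤ N) (hor : t N₀ ≠ 0 ∨ N₀ = M) {k k' : Fin (m + 1)} :
    rk (J N₀) k = rk (J N₀) k' ↔ key (J M) (pos J (J M) t) k = key (J M) (pos J (J M) t) k' := by
  have hmem := fun l => mem_jumps_least ht hJ hM hle hor (l := l)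
  constructor
  · intro h
    refine eq_of_rk_eq (fun l hl => ?_) h
    rw [hmem, not_or, not_not] at hl
    have h1 := pos_sub J (J M) t hl.1
    rw [hl.2, sub_eq_zero] at h1
    unfold key
    rw [h1, rk_succ, if_neg hl.1, add_zero]
  · refine rk_eq_of_eq (monotone_key_pos J (J M) ht) fun l hl heq => ?_
    have heq' := Prod.ext_iff.1 (toLex.injective heq)
    dsimp only at heq'
    by_cases hlM : l ∈ J M
    · exact ((rk_castSucc_lt_succ _ _).2 hlM).ne heq'.1
    · have hg := ((hmem l).1 hl).resolve_left hlM
      rw [← pos_sub J (J M) t hlM, heq'.2, sub_self] at hg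
      exact hg rfl

/-- Different adapted permutations describe the same least matrix, and the keys are constant on its
blocks. So the configuration depends on the chain alone. -/
theorem keyConf_eq_of_adapted {M : CM (m + 1)} {t : CM (m + 1) → ℝ} (ht : t ∈ chainCone M)
    {τ τ' : Equiv.Perm (Fin (m + 1))} (hτ : M.Adapted t τ) (hτ' : M.Adapted t τ') :
    M.keyConf t τ = M.keyConf t τ' := by
  obtain ⟨N₀, hM, hle, hor⟩ := exists_least ht
  have h0 : ∀ {τ}, M.Adapted t τ → N₀.Sorts τ := by
    intro τ hτ
    rcases hor with h | rfl
    exacts [hτ.2 _ h, hτ.1]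
  refine conf_eq_of_factor
    (fun k l => (key_pos_eq ht.1 antitone_rowJumps hM hle hor).1)
    (fun k l => (key_pos_eq ht.1 antitone_colJumps hM hle hor).1) ?_
  rw [← (h0 hτ).pts_eq, ← (h0 hτ').pts_eq]

end CM

/-! ### Decomposition of gap functions into levels -/

namespace CM

open PosetNerve MeasureTheory

variable {m : ℕ}

/-- The jump set obtained from `A` by adding the places where `u` is at least `θ`. -/
noncomputable def layer (A : Finset (Fin m)) (u : Fin m → ℝ) (θ : ℝ) : Finset (Fin m) :=
  A ∪ Finset.univ.filter fun l => θ ≤ u l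

theorem mem_layer {A : Finset (Fin m)} {u : Fin m → ℝ} {θ : ℝ} {l : Fin m} :
    l ∈ layer A u θ ↔ l ∈ A ∨ θ ≤ u l := by
  simp [layer]

theorem layer_subset_layer (A : Finset (Fin m)) (u : Fin m → ℝ) {θ θ' : ℝ} (h : θ ≤ θ') :
    layer A u θ' ⊆ layer A u θ := by
  intro l hl
  rw [mem_layer] at hl ⊢
  exact hl.imp_right h.trans

/-- The matrix with the gaps of size at least `θ` not contracted. -/
noncomputable def level (M : CM (m + 1)) (u v : Fin m → ℝ) (τ : Equiv.Perm (Fin (m + 1)))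
    (θ : ℝ) : CM (m + 1) :=
  ofJumps (layer M.rowJumps u θ) (layer M.colJumps v θ) τ

theorem level_mono (M : CM (m + 1)) (u v : Fin m → ℝ) (τ : Equiv.Perm (Fin (m + 1))) :
    Monotone (M.level u v τ) := fun _ _ h =>
  ofJumps_le_ofJumps (layer_subset_layer _ _ h) (layer_subset_layer _ _ h) τ

/-- The parameters `θ > 0` at which the level is `S`. -/
def levelSet (M : CM (m + 1)) (u v : Fin m → ℝ) (τ : Equiv.Perm (Fin (m + 1)))
    (S : CM (m + 1)) : Set ℝ :=
  {θ | 0 < θ ∧ M.level u v τ θ = S}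

theorem measurableSet_levelSet (M : CM (m + 1)) (u v : Fin m → ℝ) (τ : Equiv.Perm (Fin (m + 1)))
    (S : CM (m + 1)) : MeasurableSet (M.levelSet u v τ S) := by
  refine Set.OrdConnected.measurableSet ⟨?_⟩
  rintro a ⟨ha0, ha⟩ b ⟨-, hb⟩ c ⟨hac, hcb⟩
  refine ⟨ha0.trans_le hac, le_antisymm ?_ ?_⟩
  · exact hb ▸ level_mono M u v τ hcb
  · exact ha ▸ level_mono M u v τ hac

/-- A threshold larger than all gaps contracts everything down to `M`, so the other levels occur at
bounded thresholds only. -/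
theorem levelSet_subset {M : CM (m + 1)} {u v : Fin m → ℝ} {τ : Equiv.Perm (Fin (m + 1))}
    (hτ : M.Sorts τ) {S : CM (m + 1)} (hS : S ≠ M) {C : ℝ} (hu : ∀ l, u l ≤ C)
    (hv : ∀ l, v l ≤ C) : M.levelSet u v τ S ⊆ Set.Ioc 0 C := by
  rintro θ ⟨h0, rfl⟩
  refine ⟨h0, ?_⟩
  by_contra! hC
  apply hS
  have h1 : ∀ (A : Finset (Fin m)) (u : Fin m → ℝ), (∀ l, u l ≤ C) → layer A u θ = A := by
    intro A u hu
    ext l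
    rw [mem_layer]
    exact or_iff_left (not_le.2 ((hu l).trans_lt hC))
  unfold level
  rw [h1 _ _ hu, h1 _ _ hv]
  exact hτ.symm

theorem exists_bound (u v : Fin m → ℝ) : ∃ C, (∀ l, u l ≤ C) ∧ ∀ l, v l ≤ C := by
  obtain ⟨a, ha⟩ := (Set.finite_range u).bddAbove
  obtain ⟨b, hb⟩ := (Set.finite_range v).bddAbove
  exact ⟨max a b, fun l => (ha ⟨l, rfl⟩).trans (le_max_left _ _),
    fun l => (hb ⟨l, rfl⟩).trans (le_max_right _ _)⟩

theorem levelSet_ne_top {M : CM (m + 1)} {u v : Fin m → ℝ} {τ : Equiv.Perm (Fin (m + 1))}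
    (hτ : M.Sorts τ) {S : CM (m + 1)} (hS : S ≠ M) : volume (M.levelSet u v τ S) ≠ ⊤ := by
  obtain ⟨C, hu, hv⟩ := exists_bound u v
  exact ((measure_mono (levelSet_subset hτ hS hu hv)).trans_lt measure_Ioc_lt_top).ne

theorem disjoint_levelSet (M : CM (m + 1)) (u v : Fin m → ℝ) (τ : Equiv.Perm (Fin (m + 1)))
    (s : Set (CM (m + 1))) : s.PairwiseDisjoint (M.levelSet u v τ) := by
  intro S _ S' _ hne
  rw [Function.onFun, Set.disjoint_left]
  rintro θ ⟨-, h⟩ ⟨-, h'⟩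
  exact hne (h.symm.trans h')

open Classical in
/-- The weight function whose value at `S` is the length of the set of parameters of level `S`. -/
noncomputable def levelWeight (M : CM (m + 1)) (u v : Fin m → ℝ) (τ : Equiv.Perm (Fin (m + 1)))
    (S : CM (m + 1)) : ℝ :=
  if S = M then 0 else volume.real (M.levelSet u v τ S)

theorem exists_of_levelWeight_ne_zero {M : CM (m + 1)} {u v : Fin m → ℝ}
    {τ : Equiv.Perm (Fin (m + 1))} {S : CM (m + 1)} (h : M.levelWeight u v τ S ≠ 0) :
    S ≠ M ∧ ∃ θ, 0 < θ ∧ M.level u v τ θ = S := by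
  unfold levelWeight at h
  split_ifs at h with hS
  · exact absurd rfl h
  refine ⟨hS, ?_⟩
  by_contra hne
  apply h
  have : M.levelSet u v τ S = ∅ := by
    ext θ
    exact ⟨fun hθ => hne ⟨θ, hθ⟩, fun hθ => absurd hθ (Set.notMem_empty θ)⟩
  rw [this]
  simp

theorem levelWeight_mem {M : CM (m + 1)} (u v : Fin m → ℝ) {τ : Equiv.Perm (Fin (m + 1))}
    (hτ : M.Sorts τ) : M.levelWeight u v τ ∈ chainCone M := by
  refine ⟨fun S => ?_, ?_, ?_⟩
  · unfold levelWeight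
    split_ifs
    exacts [le_rfl, measureReal_nonneg]
  · intro S hS S' hS' _
    obtain ⟨-, θ, -, rfl⟩ := exists_of_levelWeight_ne_zero hS
    obtain ⟨-, θ', -, rfl⟩ := exists_of_levelWeight_ne_zero hS'
    exact (le_total θ θ').imp (fun h => level_mono M u v τ h) (fun h => level_mono M u v τ h)
  · intro S hS
    obtain ⟨hne, θ, -, rfl⟩ := exists_of_levelWeight_ne_zero hS
    refine lt_of_le_of_ne ?_ hne
    conv_rhs => rw [hτ]
    exact ofJumps_le_ofJumps Finset.subset_union_left Finset.subset_union_left τ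

theorem adapted_levelWeight {M : CM (m + 1)} (u v : Fin m → ℝ) {τ : Equiv.Perm (Fin (m + 1))}
    (hτ : M.Sorts τ) : M.Adapted (M.levelWeight u v τ) τ := by
  refine ⟨hτ, fun S hS => ?_⟩
  obtain ⟨-, θ, -, rfl⟩ := exists_of_levelWeight_ne_zero hS
  exact sorts_ofJumps _ _ τ

/-- Layer-cake formula: the level sets of the matrices with a jump at `l` partition `(0, w l]`, and
their lengths add up to `w l`. -/
theorem gap_levelWeight {M : CM (m + 1)} {u v w : Fin m → ℝ} {τ : Equiv.Perm (Fin (m + 1))}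
    (hτ : M.Sorts τ) {J : CM (m + 1) → Finset (Fin m)} {l : Fin m}
    (hJ : ∀ θ, J (M.level u v τ θ) = layer (J M) w θ) (hl : l ∉ J M) (hw : 0 ≤ w l) :
    gap J (M.levelWeight u v τ) l = w l := by
  classical
  have h1 : gap J (M.levelWeight u v τ) l =
      ∑ S with l ∈ J S, volume.real (M.levelSet u v τ S) := by
    unfold gap
    rw [Finset.sum_filter]
    refine Finset.sum_congr rfl fun S _ => ?_
    split_ifs with h
    · have hS : S ≠ M := by
        rintro rfl
        exact hl h
      rw [levelWeight, if_neg hS]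
    · rfl
  have h2 : (⋃ S ∈ Finset.univ.filter fun S => l ∈ J S, M.levelSet u v τ S) = Set.Ioc 0 (w l) := by
    ext θ
    simp only [Set.mem_iUnion, Finset.mem_filter, Finset.mem_univ, true_and, exists_prop,
      Set.mem_Ioc]
    constructor
    · rintro ⟨S, hS, h0, rfl⟩
      rw [hJ, mem_layer] at hS
      exact ⟨h0, hS.resolve_left hl⟩
    · rintro ⟨h0, hθ⟩
      refine ⟨_, ?_, h0, rfl⟩
      rw [hJ, mem_layer]
      exact Or.inr hθ
  have h3 : ∀ S ∈ Finset.univ.filter fun S => l ∈ J S, volume (M.levelSet u v τ S) ≠ ⊤ := by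
    intro S hS
    refine levelSet_ne_top hτ ?_
    rintro rfl
    exact hl (Finset.mem_filter.1 hS).2
  rw [h1, ← measureReal_biUnion_finset (disjoint_levelSet M u v τ _)
    (fun S _ => measurableSet_levelSet M u v τ S) h3, h2, Real.volume_real_Ioc_of_le hw, sub_zero]

-- Jump sets shrink along the chain. If `S` has the jump `l`, so has everything below it, and the
-- gap is at least the upper bound for `θ`; if not, only matrices strictly below `S` contribute, and
-- the gap is at most the lower bound.
open Classical in
theorem layer_gap_eq {M S : CM (m + 1)} {t : CM (m + 1) → ℝ} (ht : t ∈ chainCone M)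
    {J : CM (m + 1) → Finset (Fin m)} (hJ : ∀ {M N}, M ≤ N → J N ⊆ J M) (hS : t S ≠ 0) {θ : ℝ}
    (h1 : ∑ N with N < S, t N < θ) (h2 : θ ≤ ∑ N with N ≤ S, t N) :
    layer (J M) (gap J t) θ = J S := by
  ext l
  rw [mem_layer]
  constructor
  · rintro (h | h)
    · exact hJ (ht.2.2 hS).le h
    · by_contra hl
      refine absurd (h1.trans_le h) (not_lt.2 ?_)
      unfold gap
      rw [Finset.sum_filter]
      refine Finset.sum_le_sum fun N _ => ?_
      by_cases hN : t N = 0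
      · simp [hN]
      by_cases hlN : l ∈ J N
      · have hlt : N < S := by
          rcases ht.2.1.total hN hS with h | h
          · refine lt_of_le_of_ne h ?_
            rintro rfl
            exact hl hlN
          · exact absurd (hJ h hlN) hl
        rw [if_pos hlN, if_pos hlt]
      · rw [if_neg hlN]
        split_ifs
        exacts [ht.1 N, le_rfl]
  · intro hl
    refine Or.inr (h2.trans ?_)
    unfold gap
    rw [Finset.sum_filter]
    refine Finset.sum_le_sum fun N _ => ?_
    split_ifs with hN hN' hN'
    · exact le_rfl
    · exact absurd (hJ hN hl) hN'
    · exact ht.1 N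
    · exact le_rfl

/-- By `layer_gap_eq` each level set contains an interval of length `t S`, while the disjoint level
sets all lie in `(0, ∑ N, t N]`. The total length leaves no room, so every inequality is an
equality. -/
theorem eq_levelWeight {M : CM (m + 1)} {t : CM (m + 1) → ℝ} (ht : t ∈ chainCone M)
    {τ : Equiv.Perm (Fin (m + 1))} (hτ : M.Adapted t τ) :
    t = M.levelWeight (gap rowJumps t) (gap colJumps t) τ := by
  classical
  set u := gap rowJumps t with hu
  set v := gap colJumps t with hv
  have htM : t M = 0 := by
    by_contra h
    exact lt_irrefl M (ht.2.2 h)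
  have hle : ∀ S ∈ Finset.univ.erase M, t S ≤ volume.real (M.levelSet u v τ S) := by
    intro S hS
    by_cases h0 : t S = 0
    · rw [h0]
      exact measureReal_nonneg
    have hc : ∑ N with N ≤ S, t N = ∑ N with N < S, t N + t S := by
      have : (Finset.univ.filter fun N => N ≤ S) = insert S (Finset.univ.filter fun N => N < S) := by
        ext N
        simp [le_iff_eq_or_lt]
      rw [this, Finset.sum_insert (by simp), add_comm]
    have hsub : Set.Ioc (∑ N with N < S, t N) (∑ N with N ≤ S, t N) ⊆ M.levelSet u v τ S := by
      rintro θ ⟨h1, h2⟩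
      refine ⟨lt_of_le_of_lt (Finset.sum_nonneg fun N _ => ht.1 N) h1, ?_⟩
      unfold level
      rw [hu, hv, layer_gap_eq ht antitone_rowJumps h0 h1 h2,
        layer_gap_eq ht antitone_colJumps h0 h1 h2]
      exact (hτ.2 S h0).symm
    have := measureReal_mono (μ := volume) hsub
      (levelSet_ne_top hτ.1 (Finset.ne_of_mem_erase hS))
    rw [Real.volume_real_Ioc_of_le (by rw [hc]; linarith [ht.1 S]), hc] at this
    linarith
  have hsum : ∑ S ∈ Finset.univ.erase M, volume.real (M.levelSet u v τ S) ≤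
      ∑ S ∈ Finset.univ.erase M, t S := by
    rw [← measureReal_biUnion_finset (disjoint_levelSet M u v τ _)
      (fun S _ => measurableSet_levelSet M u v τ S)
      (fun S hS => levelSet_ne_top hτ.1 (Finset.ne_of_mem_erase hS))]
    have hsub : (⋃ S ∈ Finset.univ.erase M, M.levelSet u v τ S) ⊆ Set.Ioc 0 (∑ N, t N) :=
      Set.iUnion₂_subset fun S hS => levelSet_subset hτ.1 (Finset.ne_of_mem_erase hS)
        (fun l => gap_le_sum _ ht.1 l) (fun l => gap_le_sum _ ht.1 l)
    refine (measureReal_mono hsub measure_Ioc_lt_top.ne).trans ?_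
    rw [Real.volume_real_Ioc_of_le (Finset.sum_nonneg fun N _ => ht.1 N), sub_zero,
      Finset.sum_erase _ htM]
  have heq := (Finset.sum_eq_sum_iff_of_le hle).1 (le_antisymm (Finset.sum_le_sum hle) hsum)
  funext S
  unfold levelWeight
  split_ifs with h
  · rw [h, htM]
  · exact heq S (Finset.mem_erase.2 ⟨h, Finset.mem_univ S⟩)

theorem level_congr {M : CM (m + 1)} {u v u' v' : Fin m → ℝ} (τ : Equiv.Perm (Fin (m + 1)))
    (hu : ∀ l ∉ M.rowJumps, u l = u' l) (hv : ∀ l ∉ M.colJumps, v l = v' l) :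
    M.level u v τ = M.level u' v' τ := by
  have h : ∀ (A : Finset (Fin m)) (u u' : Fin m → ℝ), (∀ l ∉ A, u l = u' l) →
      layer A u = layer A u' := by
    intro A u u' h
    funext θ
    ext l
    rw [mem_layer, mem_layer]
    by_cases hl : l ∈ A
    · simp [hl]
    · rw [h l hl]
  funext θ
  unfold level
  rw [h _ _ _ hu, h _ _ _ hv]

/-- The projections of the configuration give the positions, hence the gaps, hence the jump sets of
the least matrices; the configuration itself shows that these matrices coincide. One permutation
then serves both chains, and both are the level weights of the same gaps. -/
theorem keyConf_injOn {M : CM (m + 1)} {t t' : CM (m + 1) → ℝ} (ht : t ∈ chainCone M)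
    (ht' : t' ∈ chainCone M) {τ τ' : Equiv.Perm (Fin (m + 1))} (hτ : M.Adapted t τ)
    (hτ' : M.Adapted t' τ') (h : M.keyConf t τ = M.keyConf t' τ') : t = t' := by
  have hx : pos rowJumps M.rowJumps t = pos rowJumps M.rowJumps t' := by
    have := congrArg (Multiset.map Prod.fst) h
    rw [keyConf, keyConf, map_fst_conf, map_fst_conf] at this
    exact key_injective _ (eq_of_monotone_of_map_eq (monotone_key_pos _ _ ht.1)
      (monotone_key_pos _ _ ht'.1) this)
  have hy : pos colJumps M.colJumps t = pos colJumps M.colJumps t' := by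
    have := congrArg (Multiset.map Prod.snd) h
    rw [keyConf, keyConf, map_snd_conf, map_snd_conf] at this
    exact key_injective _ (eq_of_monotone_of_map_eq (monotone_key_pos _ _ ht.1)
      (monotone_key_pos _ _ ht'.1) this)
  have hu : ∀ l ∉ M.rowJumps, gap rowJumps t l = gap rowJumps t' l := by
    intro l hl
    rw [← pos_sub _ _ _ hl, hx, pos_sub _ _ _ hl]
  have hv : ∀ l ∉ M.colJumps, gap colJumps t l = gap colJumps t' l := by
    intro l hl
    rw [← pos_sub _ _ _ hl, hy, pos_sub _ _ _ hl]
  obtain ⟨N₀, hM, hle, hor⟩ := exists_least ht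
  obtain ⟨N₁, hM', hle', hor'⟩ := exists_least ht'
  have hrow : N₀.rowJumps = N₁.rowJumps := by
    ext l
    rw [mem_jumps_least ht.1 antitone_rowJumps hM hle hor,
      mem_jumps_least ht'.1 antitone_rowJumps hM' hle' hor']
    by_cases hl : l ∈ M.rowJumps
    · simp [hl]
    · rw [hu l hl]
  have hcol : N₀.colJumps = N₁.colJumps := by
    ext l
    rw [mem_jumps_least ht.1 antitone_colJumps hM hle hor,
      mem_jumps_least ht'.1 antitone_colJumps hM' hle' hor']
    by_cases hl : l ∈ M.colJumps
    · simp [hl]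
    · rw [hv l hl]
  have hs : N₀.Sorts τ := by
    rcases hor with h | rfl
    exacts [hτ.2 _ h, hτ.1]
  have hs' : N₁.Sorts τ' := by
    rcases hor' with h | rfl
    exacts [hτ'.2 _ h, hτ'.1]
  have hN : N₀ = N₁ := by
    rw [hs, hs', ← hrow, ← hcol, ofJumps_eq_iff]
    unfold keyConf at h
    rw [← hx, ← hy] at h
    exact conf_eq_of_factor
      (fun k l => (key_pos_eq ht.1 antitone_rowJumps hM hle hor).2)
      (fun k l => (key_pos_eq ht.1 antitone_colJumps hM hle hor).2) h
  subst hN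
  rw [eq_levelWeight ht (Adapted.of_least hM hle hs'),
    eq_levelWeight ht' hτ']
  funext S
  unfold levelWeight levelSet
  rw [level_congr τ' hu hv]

/-- Each labelled configuration that is centred comes from a weighted chain. -/
theorem exists_keyConf_eq (M : CM (m + 1)) {S : Multiset ((ℕ ×ₗ ℝ) × (ℕ ×ₗ ℝ))}
    (hS : S.map (fun z => ((ofLex z.1).1, (ofLex z.2).1)) = M.pts)
    (hrow : ∀ i, ((S.filter fun z => (ofLex z.1).1 = i).map fun z => (ofLex z.1).2).sum = 0)
    (hcol : ∀ j, ((S.filter fun z => (ofLex z.2).1 = j).map fun z => (ofLex z.2).2).sum = 0) :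
    ∃ t ∈ chainCone M, ∃ τ, M.Adapted t τ ∧ M.keyConf t τ = S := by
  have hcard : S.card = m + 1 := by rw [← M.card_pts, ← hS, Multiset.card_map]
  -- Sorting lexicographically, by label and then by position, sorts the labels as well. They are
  -- therefore the ranks for `M`, and `τ` sorts `M`.
  obtain ⟨X, τ, Y, hX, hY, rfl⟩ := exists_conf_eq hcard
  have hlab : conf (fun k => (ofLex (X k)).1) τ (fun k => (ofLex (Y k)).1) = M.pts := by
    rw [← hS, conf, conf, Multiset.map_map]
    rfl
  obtain ⟨τ', hτ'⟩ := M.exists_sorts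
  have mono_fst : ∀ {X : Fin (m + 1) → ℕ ×ₗ ℝ}, Monotone X → Monotone fun k => (ofLex (X k)).1 :=
    fun hX k l hkl => Prod.Lex.monotone_fst _ _ (hX hkl)
  have hXA : (fun k => (ofLex (X k)).1) = rk M.rowJumps := by
    refine eq_of_monotone_of_map_eq (mono_fst hX) (monotone_rk _) ?_
    rw [← map_fst_conf (rk M.rowJumps) τ' (rk M.colJumps), ← hτ'.pts_eq, ← hlab, map_fst_conf]
  have hYB : (fun k => (ofLex (Y k)).1) = rk M.colJumps := by
    refine eq_of_monotone_of_map_eq (mono_fst hY) (monotone_rk _) ?_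
    rw [← map_snd_conf (rk M.rowJumps) τ' (rk M.colJumps), ← hτ'.pts_eq, ← hlab, map_snd_conf]
  let x : Fin (m + 1) → ℝ := fun k => (ofLex (X k)).2
  let y : Fin (m + 1) → ℝ := fun k => (ofLex (Y k)).2
  have hXk : X = key M.rowJumps x := by
    funext k
    unfold key
    rw [← hXA]
    rfl
  have hYk : Y = key M.colJumps y := by
    funext k
    unfold key
    rw [← hYB]
    rfl
  have hτ : M.Sorts τ := by
    refine pts_injective ?_
    rw [pts_ofJumps, ← hXA, ← hYB, hlab]
  have hcx : Centred M.rowJumps x := by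
    intro i
    refine Eq.trans ?_ (hrow i)
    rw [conf, Multiset.filter_map, Multiset.map_map, ← hXA]
    rfl
  have hcy : Centred M.colJumps y := by
    intro j
    refine Eq.trans ?_ (hcol j)
    rw [conf, Multiset.filter_map, Multiset.map_map, ← hYB, Finset.sum_filter]
    rw [← Equiv.sum_comp τ, ← Finset.sum_filter]
    rfl
  -- Only the increments inside the blocks matter: at a jump of `M` every layer contains `l` anyway,
  -- whatever the sign of `u l`.
  let u : Fin m → ℝ := fun l => x l.succ - x l.castSucc
  let v : Fin m → ℝ := fun l => y l.succ - y l.castSucc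
  refine ⟨M.levelWeight u v τ, levelWeight_mem u v hτ, τ, adapted_levelWeight u v hτ, ?_⟩
  have hpx : pos rowJumps M.rowJumps (M.levelWeight u v τ) = x := by
    refine (centred_centre _ _).ext hcx fun l hl => ?_
    refine (pos_sub _ _ _ hl).trans (gap_levelWeight (w := u) hτ
      (fun θ => rowJumps_ofJumps _ _ _) hl ?_)
    exact sub_nonneg.2 (le_succ_of_monotone_key (hXk ▸ hX) hl)
  have hpy : pos colJumps M.colJumps (M.levelWeight u v τ) = y := by
    refine (centred_centre _ _).ext hcy fun l hl => ?_
    refine (pos_sub _ _ _ hl).trans (gap_levelWeight (w := v) hτ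
      (fun θ => colJumps_ofJumps _ _ _) hl ?_)
    exact sub_nonneg.2 (le_succ_of_monotone_key (hYk ▸ hY) hl)
  rw [keyConf, hpx, hpy, ← hXk, ← hYk]

end CM

/-! ### Making coefficients homogeneous -/

section Homog

/-- Take the `w`-th root of the absolute value of a complex number, keeping its argument. -/
noncomputable def homog (w : ℕ) (c : ℂ) : ℂ := (‖c‖ ^ ((w : ℝ)⁻¹) / ‖c‖) • c

theorem norm_homog {w : ℕ} (hw : w ≠ 0) (c : ℂ) : ‖homog w c‖ = ‖c‖ ^ ((w : ℝ)⁻¹) := by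
  unfold homog
  rw [norm_smul, Real.norm_of_nonneg (by positivity)]
  by_cases h : c = 0
  · subst h
    rw [norm_zero, mul_zero, Real.zero_rpow]
    positivity
  · exact div_mul_cancel₀ _ (norm_ne_zero_iff.2 h)

theorem homog_zero (w : ℕ) : homog w 0 = 0 := by simp [homog]

theorem homog_one (c : ℂ) : homog 1 c = c := by
  unfold homog
  by_cases h : c = 0
  · simp [h]
  · simp [h]

/-- A dilation by `r` multiplies a coefficient of weight `w` by `r ^ w`; taking the root of the
modulus turns this factor into `r`. -/
theorem homog_smul {w : ℕ} (hw : w ≠ 0) {r : ℝ} (hr : 0 ≤ r) (c : ℂ) :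
    homog w (r ^ w • c) = r • homog w c := by
  unfold homog
  by_cases hc : c = 0
  · simp [hc]
  rcases hr.eq_or_lt with rfl | hr
  · simp [hw]
  have hn : ‖r ^ w • c‖ = r ^ w * ‖c‖ := by
    rw [norm_smul, Real.norm_of_nonneg (by positivity)]
  have h1 : (r ^ w * ‖c‖) ^ ((w : ℝ)⁻¹) = r * ‖c‖ ^ ((w : ℝ)⁻¹) := by
    rw [Real.mul_rpow (by positivity) (norm_nonneg _), Real.pow_rpow_inv_natCast hr.le hw]
  rw [hn, h1, smul_smul, smul_smul]
  congr 1
  have := norm_ne_zero_iff.2 hc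
  field_simp

theorem homog_bijective {w : ℕ} (hw : w ≠ 0) : Function.Bijective (homog w) := by
  constructor
  · intro c d h
    have hn : ‖c‖ = ‖d‖ := by
      have := congrArg norm h
      rw [norm_homog hw, norm_homog hw] at this
      exact (Real.rpow_left_injOn (by positivity : ((w : ℝ)⁻¹) ≠ 0)) (norm_nonneg c) (norm_nonneg d) this
    by_cases hc : c = 0
    · subst hc
      rw [norm_zero] at hn
      exact (norm_eq_zero.1 hn.symm).symm
    · have hc' := norm_pos_iff.2 hc
      unfold homog at h
      rw [← hn] at h
      exact smul_right_injective _ (by positivity) h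
  · intro d
    by_cases hd : d = 0
    · exact ⟨0, by rw [homog_zero, hd]⟩
    refine ⟨‖d‖ ^ (w - 1) • d, ?_⟩
    have hd' := norm_ne_zero_iff.2 hd
    have hn : ‖‖d‖ ^ (w - 1) • d‖ = ‖d‖ ^ w := by
      rw [norm_smul, norm_pow, norm_norm, pow_sub_one_mul hw]
    unfold homog
    rw [hn, Real.pow_rpow_inv_natCast (norm_nonneg _) hw, smul_smul]
    have : ‖d‖ / ‖d‖ ^ w * ‖d‖ ^ (w - 1) = 1 := by
      rw [div_mul_eq_mul_div, mul_comm, pow_sub_one_mul hw, div_self (pow_ne_zero _ hd')]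
    rw [this, one_smul]

theorem continuous_homog {w : ℕ} (hw : w ≠ 0) : Continuous (homog w) := by
  rw [continuous_iff_continuousAt]
  intro c
  by_cases hc : c = 0
  · subst hc
    rw [ContinuousAt, homog_zero, tendsto_zero_iff_norm_tendsto_zero]
    simp only [norm_homog hw]
    have : Continuous fun c : ℂ => ‖c‖ ^ ((w : ℝ)⁻¹) :=
      continuous_norm.rpow_const fun c => Or.inr (by positivity)
    have h := this.tendsto 0
    rwa [norm_zero, Real.zero_rpow (by positivity)] at h
  · have hn := norm_ne_zero_iff.2 hc
    exact ((continuous_norm.continuousAt.rpow_const (Or.inl hn)).div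
      continuous_norm.continuousAt hn).smul continuousAt_id

end Homog

/-! ### Polynomials with prescribed roots -/

section Roots

open Polynomial

/-- The monic polynomial with a given multiset of roots. -/
noncomputable def rootsPoly (s : Multiset ℂ) : ℂ[X] := (s.map fun z => X - C z).prod

theorem monic_rootsPoly (s : Multiset ℂ) : (rootsPoly s).Monic :=
  monic_multisetProd_X_sub_C s

theorem natDegree_rootsPoly (s : Multiset ℂ) : (rootsPoly s).natDegree = s.card :=
  natDegree_multiset_prod_X_sub_C_eq_card s

theorem roots_rootsPoly (s : Multiset ℂ) : (rootsPoly s).roots = s :=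
  roots_multiset_prod_X_sub_C s

theorem rootsPoly_coeff_card_sub_one {s : Multiset ℂ} (hs : s.card ≠ 0) :
    (rootsPoly s).coeff (s.card - 1) = -s.sum :=
  multiset_prod_X_sub_C_coeff_card_pred s (Nat.pos_of_ne_zero hs)

theorem eq_of_rootsPoly_coeff_eq {s t : Multiset ℂ} (hst : s.card = t.card)
    (h : ∀ k < s.card, (rootsPoly s).coeff k = (rootsPoly t).coeff k) : s = t := by
  rw [← roots_rootsPoly s, ← roots_rootsPoly t]
  congr 1
  ext k
  rcases lt_trichotomy k s.card with hk | rfl | hk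
  · exact h k hk
  · have h1 := (monic_rootsPoly s).coeff_natDegree
    have h2 := (monic_rootsPoly t).coeff_natDegree
    rw [natDegree_rootsPoly] at h1 h2
    rw [h1, hst, h2]
  · rw [coeff_eq_zero_of_natDegree_lt, coeff_eq_zero_of_natDegree_lt]
    · rwa [natDegree_rootsPoly, ← hst]
    · rwa [natDegree_rootsPoly]

/-- Algebraic closedness of `ℂ` makes the lower coefficients free coordinates on multisets of size
`d`. -/
theorem exists_rootsPoly_coeff_eq {d : ℕ} (c : Fin d → ℂ) :
    ∃ s : Multiset ℂ, s.card = d ∧ ∀ k : Fin d, (rootsPoly s).coeff k = c k := by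
  let r : ℂ[X] := ∑ k : Fin d, C (c k) * X ^ (k : ℕ)
  have hr : r.degree < d := degree_sum_fin_lt c
  have hmonic : (X ^ d + r).Monic := monic_X_pow_add hr
  have hdeg : (X ^ d + r).natDegree = d := by
    refine natDegree_eq_of_degree_eq_some ?_
    rw [degree_add_eq_left_of_degree_lt (by rwa [degree_X_pow]), degree_X_pow]
  have hprod : rootsPoly (X ^ d + r).roots = X ^ d + r :=
    ((IsAlgClosed.splits (X ^ d + r)).eq_prod_roots_of_monic hmonic).symm
  refine ⟨(X ^ d + r).roots, ?_, fun k => ?_⟩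
  · rw [← natDegree_rootsPoly, hprod, hdeg]
  · rw [hprod, coeff_add, coeff_X_pow, if_neg k.2.ne, zero_add, finsetSum_coeff]
    simp only [coeff_C_mul, coeff_X_pow, mul_ite, mul_one, mul_zero]
    rw [Finset.sum_eq_single k]
    · simp
    · intro b _ hb
      rw [if_neg]
      exact fun h => hb (Fin.ext h.symm)
    · simp

theorem rootsPoly_map_smul_coeff (s : Multiset ℂ) (r : ℝ) {k : ℕ} :
    (rootsPoly (s.map fun z => r • z)).coeff k = r ^ (s.card - k) • (rootsPoly s).coeff k := by
  have h : rootsPoly (s.map fun z => r • z) = (rootsPoly s).scaleRoots (r : ℂ) := by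
    induction s using Multiset.induction with
    | empty => simp [rootsPoly]
    | cons a s ih =>
      unfold rootsPoly at ih ⊢
      rw [Multiset.map_cons, Multiset.map_cons, Multiset.prod_cons, Multiset.map_cons,
        Multiset.prod_cons, mul_scaleRoots_of_noZeroDivisors, ih]
      congr 1
      rw [X_sub_C_scaleRoots]
      simp [mul_comm]
  rw [h, coeff_scaleRoots, natDegree_rootsPoly, Complex.real_smul, mul_comm]
  push_cast
  rfl

theorem continuous_rootsPoly_coeff {ι Y : Type} [TopologicalSpace Y] (s : Finset ι)
    {f : ι → Y → ℂ} (hf : ∀ i, Continuous (f i)) (k : ℕ) :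
    Continuous fun y => (rootsPoly (s.val.map fun i => f i y)).coeff k := by
  classical
  induction s using Finset.induction generalizing k with
  | empty => simpa [rootsPoly] using continuous_const
  | insert a s ha ih =>
    have : ∀ y, rootsPoly ((insert a s).val.map fun i => f i y) =
        (X - C (f a y)) * rootsPoly (s.val.map fun i => f i y) := by
      intro y
      rw [Finset.insert_val_of_notMem ha, rootsPoly, Multiset.map_cons, Multiset.map_cons,
        Multiset.prod_cons, rootsPoly]
    simp only [this, sub_mul, coeff_sub, coeff_C_mul]
    cases k with
    | zero =>
      simp only [coeff_X_mul_zero, zero_sub]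
      exact ((hf a).mul (ih 0)).neg
    | succ k =>
      simp only [coeff_X_mul]
      exact (ih k).sub ((hf a).mul (ih (k + 1)))

end Roots

/-! ### Labelled configurations and their coefficients -/

namespace CM

open Polynomial

variable {n : ℕ}

/-- The index set of the coefficients of a family of monic polynomials, one for each entry of `M`,
with degrees the entries of `M`. -/
abbrev CoeffIndex (M : CM n) : Type :=
  Σ b : Fin M.rows × Fin M.cols, Fin (M.mat.entry b.1 b.2)

/-- The points of a labelled configuration with label `b`. -/
def block (Z : Multiset ((ℕ × ℕ) × ℂ)) (b : ℕ × ℕ) : Multiset ℂ :=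
  (Z.filter fun z => z.1 = b).map Prod.snd

theorem card_block {Z : Multiset ((ℕ × ℕ) × ℂ)} (b : ℕ × ℕ) :
    (block Z b).card = (Z.map Prod.fst).count b := by
  unfold block
  rw [Multiset.card_map, Multiset.count_map]
  simp only [eq_comm]

theorem card_block_eq {M : CM n} {Z : Multiset ((ℕ × ℕ) × ℂ)} (hZ : Z.map Prod.fst = M.pts)
    (b : Fin M.rows × Fin M.cols) :
    (block Z (b.1.1, b.2.1)).card = M.mat.entry b.1 b.2 := by
  rw [card_block, hZ, count_pts]

theorem count_block (Z : Multiset ((ℕ × ℕ) × ℂ)) (b : ℕ × ℕ) (z : ℂ) :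
    (block Z b).count z = Z.count (b, z) := by
  classical
  unfold block
  rw [Multiset.count_map, Multiset.filter_filter, Multiset.count, Multiset.countP_eq_card_filter]
  congr 1
  refine Multiset.filter_congr fun w _ => ?_
  constructor
  · rintro ⟨h1, h2⟩
    exact Prod.ext h2.symm h1
  · rintro rfl
    exact ⟨rfl, rfl⟩

/-- The configuration with given points for each label. -/
def ofBlocks (M : CM n) (s : Fin M.rows × Fin M.cols → Multiset ℂ) : Multiset ((ℕ × ℕ) × ℂ) :=
  ∑ b, (s b).map fun z => ((b.1.1, b.2.1), z)

theorem block_ofBlocks (M : CM n) (s : Fin M.rows × Fin M.cols → Multiset ℂ)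
    (b : Fin M.rows × Fin M.cols) : block (M.ofBlocks s) (b.1.1, b.2.1) = s b := by
  classical
  ext z
  rw [count_block, ofBlocks, Multiset.count_sum', Finset.sum_eq_single b]
  · exact Multiset.count_map_eq_count' _ _ (fun x y h => (Prod.ext_iff.1 h).2) z
  · intro c _ hc
    refine Multiset.count_eq_zero_of_notMem fun h => hc ?_
    obtain ⟨w, -, hw⟩ := Multiset.mem_map.1 h
    have h1 := Prod.ext_iff.1 (Prod.ext_iff.1 hw).1
    exact Prod.ext (Fin.ext h1.1) (Fin.ext h1.2)
  · simp

theorem ofBlocks_block {M : CM n} {Z : Multiset ((ℕ × ℕ) × ℂ)} (hZ : Z.map Prod.fst = M.pts) :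
    M.ofBlocks (fun b => block Z (b.1.1, b.2.1)) = Z := by
  classical
  ext ⟨⟨i, j⟩, z⟩
  rw [← count_block, ← count_block]
  by_cases h : i < M.rows ∧ j < M.cols
  · exact congrArg _ (block_ofBlocks M (fun b => block Z (b.1.1, b.2.1)) (⟨i, h.1⟩, ⟨j, h.2⟩))
  · rw [count_block, count_block, Multiset.count_eq_zero_of_notMem, Multiset.count_eq_zero_of_notMem]
    · intro hmem
      have := Multiset.mem_map_of_mem Prod.fst hmem
      rw [hZ, mem_pts] at this
      obtain ⟨i', j', -, hij⟩ := this
      rw [Prod.ext_iff] at hij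
      exact h ⟨lt_of_eq_of_lt hij.1 i'.2, lt_of_eq_of_lt hij.2 j'.2⟩
    · intro hmem
      rw [ofBlocks, Multiset.mem_sum] at hmem
      obtain ⟨b, -, hb⟩ := hmem
      obtain ⟨w, -, hw⟩ := Multiset.mem_map.1 hb
      have h1 := Prod.ext_iff.1 (Prod.ext_iff.1 hw).1
      exact h ⟨lt_of_eq_of_lt h1.1.symm b.1.2, lt_of_eq_of_lt h1.2.symm b.2.2⟩

theorem map_fst_ofBlocks (M : CM n) {s : Fin M.rows × Fin M.cols → Multiset ℂ}
    (hs : ∀ b, (s b).card = M.mat.entry b.1 b.2) : (M.ofBlocks s).map Prod.fst = M.pts := by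
  unfold ofBlocks pts
  rw [← Multiset.coe_mapAddMonoidHom, map_sum, ← Finset.univ_product_univ, Finset.sum_product]
  refine Finset.sum_congr rfl fun i _ => Finset.sum_congr rfl fun j _ => ?_
  rw [Multiset.coe_mapAddMonoidHom, Multiset.map_map, Multiset.nsmul_singleton]
  exact (Multiset.map_const' _ _).trans (by rw [hs])

/-- The coordinates of a labelled configuration: the coefficients of the polynomials whose roots
are the points with a given label, made homogeneous. -/
noncomputable def coords (M : CM n) (Z : Multiset ((ℕ × ℕ) × ℂ)) (e : M.CoeffIndex) : ℂ :=
  homog (M.mat.entry e.1.1 e.1.2 - e.2) ((rootsPoly (block Z (e.1.1.1, e.1.2.1))).coeff e.2)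

theorem weight_ne_zero {M : CM n} (e : M.CoeffIndex) : M.mat.entry e.1.1 e.1.2 - (e.2 : ℕ) ≠ 0 :=
  Nat.sub_ne_zero_of_lt e.2.2

theorem coords_injOn {M : CM n} {Z Z' : Multiset ((ℕ × ℕ) × ℂ)} (hZ : Z.map Prod.fst = M.pts)
    (hZ' : Z'.map Prod.fst = M.pts) (h : M.coords Z = M.coords Z') : Z = Z' := by
  rw [← ofBlocks_block hZ, ← ofBlocks_block hZ']
  congr 1
  funext b
  refine eq_of_rootsPoly_coeff_eq ?_ fun k hk => ?_
  · rw [card_block_eq hZ, card_block_eq hZ']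
  · rw [card_block_eq hZ] at hk
    exact (homog_bijective (weight_ne_zero ⟨b, k, hk⟩)).1 (congrFun h ⟨b, k, hk⟩)

theorem exists_coords_eq (M : CM n) (w : M.CoeffIndex → ℂ) :
    ∃ Z : Multiset ((ℕ × ℕ) × ℂ), Z.map Prod.fst = M.pts ∧ M.coords Z = w := by
  choose c hc using fun e : M.CoeffIndex => (homog_bijective (weight_ne_zero e)).2 (w e)
  choose s hs hs' using fun b : Fin M.rows × Fin M.cols =>
    exists_rootsPoly_coeff_eq fun k => c ⟨b, k⟩
  refine ⟨M.ofBlocks s, map_fst_ofBlocks M hs, ?_⟩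
  funext e
  unfold coords
  rw [block_ofBlocks, hs', hc]

theorem coords_map_smul {M : CM n} {Z : Multiset ((ℕ × ℕ) × ℂ)} (hZ : Z.map Prod.fst = M.pts)
    {r : ℝ} (hr : 0 ≤ r) :
    M.coords (Z.map fun z => (z.1, r • z.2)) = r • M.coords Z := by
  funext e
  have h : block (Z.map fun z => (z.1, r • z.2)) (e.1.1.1, e.1.2.1) =
      (block Z (e.1.1.1, e.1.2.1)).map fun z => r • z := by
    unfold block
    rw [Multiset.filter_map, Multiset.map_map, Multiset.map_map]
    rfl
  unfold coords
  rw [Pi.smul_apply, h, rootsPoly_map_smul_coeff, card_block_eq hZ e.1,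
    homog_smul (weight_ne_zero e) hr]

/-- The sum of the real parts of the subleading coefficients in a row and of the imaginary parts
of the subleading coefficients in a column. -/
noncomputable def moments (M : CM n) :
    (M.CoeffIndex → ℂ) →ₗ[ℝ] (Fin M.rows → ℝ) × (Fin M.cols → ℝ) where
  toFun w :=
    (fun i => ∑ j, ∑ k : Fin (M.mat.entry i j),
      if (k : ℕ) + 1 = M.mat.entry i j then (w ⟨(i, j), k⟩).re else 0,
    fun j => ∑ i, ∑ k : Fin (M.mat.entry i j),
      if (k : ℕ) + 1 = M.mat.entry i j then (w ⟨(i, j), k⟩).im else 0)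
  map_add' w w' := by
    ext
    · simp only [Pi.add_apply, Complex.add_re, Prod.fst_add, ← Finset.sum_add_distrib]
      refine Finset.sum_congr rfl fun _ _ => Finset.sum_congr rfl fun _ _ => ?_
      split_ifs <;> simp
    · simp only [Pi.add_apply, Complex.add_im, Prod.snd_add, ← Finset.sum_add_distrib]
      refine Finset.sum_congr rfl fun _ _ => Finset.sum_congr rfl fun _ _ => ?_
      split_ifs <;> simp
  map_smul' r w := by
    ext
    · simp only [Pi.smul_apply, Complex.smul_re, Prod.smul_fst, RingHom.id_apply, Finset.smul_sum,
        smul_ite, smul_zero]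
    · simp only [Pi.smul_apply, Complex.smul_im, Prod.smul_snd, RingHom.id_apply, Finset.smul_sum,
        smul_ite, smul_zero]

/-- Extracts the subleading term. For `d = 0` there is none and the sum is empty, which `h0`
accounts for. -/
theorem sum_last {d : ℕ} (f : ℂ → ℝ) (c : Fin d → ℂ) (a : ℂ) (h0 : d = 0 → f a = 0)
    (h : ∀ k : Fin d, (k : ℕ) + 1 = d → c k = a) :
    (∑ k : Fin d, if (k : ℕ) + 1 = d then f (c k) else 0) = f a := by
  obtain _ | d := d
  · simp [h0 rfl]
  · rw [Finset.sum_eq_single (Fin.last d)]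
    · rw [if_pos (by simp), h _ (by simp)]
    · intro k _ hk
      rw [if_neg]
      intro h'
      exact hk (Fin.ext (by simpa using h'))
    · simp

/-- The subleading coefficient has weight one, so `homog` leaves it unchanged. This is why the
centring conditions remain linear in the coordinates. -/
theorem coords_last {M : CM n} {Z : Multiset ((ℕ × ℕ) × ℂ)} (hZ : Z.map Prod.fst = M.pts)
    (b : Fin M.rows × Fin M.cols) (k : Fin (M.mat.entry b.1 b.2))
    (hk : (k : ℕ) + 1 = M.mat.entry b.1 b.2) :
    M.coords Z ⟨b, k⟩ = -(block Z (b.1.1, b.2.1)).sum := by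
  have hcard := card_block_eq hZ b
  unfold coords
  dsimp only
  rw [show M.mat.entry b.1 b.2 - (k : ℕ) = 1 by omega, homog_one,
    show (k : ℕ) = (block Z (b.1.1, b.2.1)).card - 1 by omega, rootsPoly_coeff_card_sub_one]
  omega

theorem sum_filter_ofBlocks (M : CM n) (s : Fin M.rows × Fin M.cols → Multiset ℂ)
    (p : ℕ × ℕ → Prop) [DecidablePred p] (f : ℂ →+ ℝ) :
    (((M.ofBlocks s).filter fun z => p z.1).map fun z => f z.2).sum =
      ∑ b : Fin M.rows × Fin M.cols, if p (b.1.1, b.2.1) then f (s b).sum else 0 := by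
  classical
  let F : Multiset ((ℕ × ℕ) × ℂ) →+ ℝ :=
    { toFun := fun Z => ((Z.filter fun z => p z.1).map fun z => f z.2).sum
      map_zero' := by simp
      map_add' := fun Z Z' => by simp }
  change F (M.ofBlocks s) = _
  unfold ofBlocks
  rw [map_sum]
  refine Finset.sum_congr rfl fun b _ => ?_
  change ((((s b).map fun z => ((b.1.1, b.2.1), z)).filter
    fun z : (ℕ × ℕ) × ℂ => p z.1).map fun z => f z.2).sum = _
  rw [Multiset.filter_map, Multiset.map_map]
  split_ifs with h
  · have hf : (s b).filter ((fun z : (ℕ × ℕ) × ℂ => p z.1) ∘ fun z => ((b.1.1, b.2.1), z)) = s b :=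
      Multiset.filter_eq_self.2 fun z _ => h
    rw [hf, map_multiset_sum]
    rfl
  · have hf : (s b).filter ((fun z : (ℕ × ℕ) × ℂ => p z.1) ∘ fun z => ((b.1.1, b.2.1), z)) = 0 :=
      Multiset.filter_eq_nil.2 fun z _ => h
    rw [hf]
    simp

theorem moments_coords {M : CM n} {Z : Multiset ((ℕ × ℕ) × ℂ)} (hZ : Z.map Prod.fst = M.pts) :
    M.moments (M.coords Z) =
      (fun i => -((Z.filter fun z => z.1.1 = i.1).map fun z => z.2.re).sum,
       fun j => -((Z.filter fun z => z.1.2 = j.1).map fun z => z.2.im).sum) := by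
  have hblock0 : ∀ b : Fin M.rows × Fin M.cols, M.mat.entry b.1 b.2 = 0 →
      -(block Z (b.1.1, b.2.1)).sum = 0 := by
    intro b hb
    rw [← card_block_eq hZ b, Multiset.card_eq_zero] at hb
    simp [hb]
  have hre : ∀ i : Fin M.rows, ((Z.filter fun z => z.1.1 = i.1).map fun z => z.2.re).sum =
      ∑ j : Fin M.cols, (block Z (i.1, j.1)).sum.re := by
    intro i
    have := sum_filter_ofBlocks M (fun b => block Z (b.1.1, b.2.1)) (fun l => l.1 = i.1)
      Complex.reAddGroupHom
    rw [ofBlocks_block hZ, ← Finset.univ_product_univ, Finset.sum_product,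
      Finset.sum_eq_single i] at this
    · simpa using this
    · intro i' _ hi'
      simp [Fin.val_inj, hi']
    · simp
  have him : ∀ j : Fin M.cols, ((Z.filter fun z => z.1.2 = j.1).map fun z => z.2.im).sum =
      ∑ i : Fin M.rows, (block Z (i.1, j.1)).sum.im := by
    intro j
    have := sum_filter_ofBlocks M (fun b => block Z (b.1.1, b.2.1)) (fun l => l.2 = j.1)
      Complex.imAddGroupHom
    rw [ofBlocks_block hZ, ← Finset.univ_product_univ, Finset.sum_product_right,
      Finset.sum_eq_single j] at this
    · simpa using this
    · intro i' _ hi'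
      simp [Fin.val_inj, hi']
    · simp
  unfold moments
  simp only [LinearMap.coe_mk, AddHom.coe_mk]
  congr 1
  · funext i
    rw [hre, ← Finset.sum_neg_distrib]
    refine Finset.sum_congr rfl fun j _ => ?_
    rw [← Complex.neg_re]
    exact sum_last Complex.re (fun k => M.coords Z ⟨(i, j), k⟩) _
      (fun h => by rw [hblock0 (i, j) h, Complex.zero_re]) fun k hk => coords_last hZ (i, j) k hk
  · funext j
    rw [him, ← Finset.sum_neg_distrib]
    refine Finset.sum_congr rfl fun i _ => ?_
    rw [← Complex.neg_im]
    exact sum_last Complex.im (fun k => M.coords Z ⟨(i, j), k⟩) _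
      (fun h => by rw [hblock0 (i, j) h, Complex.zero_im]) fun k hk => coords_last hZ (i, j) k hk

/-- Put the prescribed real part at one non-zero entry of each row and the prescribed imaginary part
at one non-zero entry of each column; the two choices do not interfere. -/
theorem moments_surjective (M : CM n) : Function.Surjective M.moments := by
  rintro ⟨α, β⟩
  choose f hf using M.mat.row_ne
  choose g hg using M.mat.col_ne
  let a : Fin M.rows × Fin M.cols → ℂ := fun b =>
    ⟨if b.2 = f b.1 then α b.1 else 0, if b.1 = g b.2 then β b.2 else 0⟩
  refine ⟨fun e => a e.1, ?_⟩
  unfold moments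
  simp only [LinearMap.coe_mk, AddHom.coe_mk]
  congr 1
  · funext i
    rw [Finset.sum_eq_single (f i)]
    · refine (sum_last Complex.re _ (a (i, f i)) (fun h => absurd h (hf i)) fun _ _ => rfl).trans ?_
      simp [a]
    · intro j _ hj
      refine Finset.sum_eq_zero fun k _ => ?_
      simp [a, hj]
    · simp
  · funext j
    rw [Finset.sum_eq_single (g j)]
    · refine (sum_last Complex.im _ (a (g j, j)) (fun h => absurd h (hg j)) fun _ _ => rfl).trans ?_
      simp [a]
    · intro i _ hi
      refine Finset.sum_eq_zero fun k _ => ?_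
      simp [a, hi]
    · simp

theorem finrank_ker_moments (M : CM n) :
    Module.finrank ℝ (LinearMap.ker M.moments) = M.cellDim := by
  have h := M.moments.finrank_range_add_finrank_ker
  rw [LinearMap.range_eq_top.2 M.moments_surjective, finrank_top, Module.finrank_prod,
    Module.finrank_fintype_fun_eq_card, Module.finrank_fintype_fun_eq_card,
    Module.finrank_pi_fintype] at h
  simp only [Complex.finrank_real_complex, Finset.sum_const, Fintype.card_fin,
    Finset.card_univ, Fintype.card_sigma, smul_eq_mul] at h
  have hw : ∑ b : Fin M.rows × Fin M.cols, M.mat.entry b.1 b.2 = n := by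
    rw [← Finset.univ_product_univ, Finset.sum_product]
    exact M.mat.weight
  rw [hw] at h
  unfold cellDim
  omega

end CM

/-! ### The parametrization of a vector space by weighted chains -/

namespace CM

open PosetNerve

variable {m : ℕ}

/-- Reorder the components of a labelled point of the plane. -/
def relabel (z : (ℕ ×ₗ ℝ) × (ℕ ×ₗ ℝ)) : (ℕ × ℕ) × ℂ :=
  (((ofLex z.1).1, (ofLex z.2).1), ⟨(ofLex z.1).2, (ofLex z.2).2⟩)

/-- The inverse of `relabel`. -/
def unlabel (z : (ℕ × ℕ) × ℂ) : (ℕ ×ₗ ℝ) × (ℕ ×ₗ ℝ) :=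
  (toLex (z.1.1, z.2.re), toLex (z.1.2, z.2.im))

theorem relabel_injective : Function.Injective relabel :=
  Function.LeftInverse.injective (g := unlabel) fun _ => rfl

/-- The configuration of labelled complex numbers described by a weighted chain. -/
noncomputable def config (M : CM (m + 1)) (t : CM (m + 1) → ℝ) (τ : Equiv.Perm (Fin (m + 1))) :
    Multiset ((ℕ × ℕ) × ℂ) :=
  Finset.univ.val.map fun k => ((rk M.rowJumps k, rk M.colJumps (τ k)),
    ⟨pos rowJumps M.rowJumps t k, pos colJumps M.colJumps t (τ k)⟩)

theorem map_relabel_keyConf (M : CM (m + 1)) (t : CM (m + 1) → ℝ)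
    (τ : Equiv.Perm (Fin (m + 1))) : (M.keyConf t τ).map relabel = M.config t τ := by
  unfold keyConf conf
  rw [Multiset.map_map]
  rfl

theorem map_fst_config {M : CM (m + 1)} {τ : Equiv.Perm (Fin (m + 1))} (hτ : M.Sorts τ)
    (t : CM (m + 1) → ℝ) : (M.config t τ).map Prod.fst = M.pts := by
  rw [hτ.pts_eq, config, Multiset.map_map]
  rfl

theorem moments_config {M : CM (m + 1)} {τ : Equiv.Perm (Fin (m + 1))} (hτ : M.Sorts τ)
    (t : CM (m + 1) → ℝ) : M.moments (M.coords (M.config t τ)) = 0 := by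
  rw [moments_coords (map_fst_config hτ t)]
  refine Prod.ext ?_ ?_
  · funext i
    change -_ = (0 : ℝ)
    rw [neg_eq_zero, config, Multiset.filter_map, Multiset.map_map]
    exact centred_centre M.rowJumps _ i
  · funext j
    change -_ = (0 : ℝ)
    rw [neg_eq_zero, config, Multiset.filter_map, Multiset.map_map]
    have h := centred_centre M.colJumps (fun k => ∑ N, t N * rk (colJumps N) k) j
    rw [Finset.sum_filter, ← Equiv.sum_comp τ, ← Finset.sum_filter] at h
    exact h

theorem pos_smul (J : CM (m + 1) → Finset (Fin m)) (A : Finset (Fin m)) (t : CM (m + 1) → ℝ)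
    (c : ℝ) (k : Fin (m + 1)) : pos J A (c • t) k = c * pos J A t k := by
  unfold pos centre
  simp only [Pi.smul_apply, smul_eq_mul, mul_assoc, ← Finset.mul_sum]
  ring

theorem continuous_pos (J : CM (m + 1) → Finset (Fin m)) (A : Finset (Fin m)) (k : Fin (m + 1)) :
    Continuous fun t => pos J A t k := by
  unfold pos centre
  fun_prop

theorem config_smul (M : CM (m + 1)) (t : CM (m + 1) → ℝ) (τ : Equiv.Perm (Fin (m + 1)))
    (c : ℝ) : M.config (c • t) τ = (M.config t τ).map fun z => (z.1, c • z.2) := by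
  unfold config
  rw [Multiset.map_map]
  refine Multiset.map_congr rfl fun k _ => ?_
  simp only [Function.comp, pos_smul]
  refine Prod.ext rfl (Complex.ext ?_ ?_) <;> simp

theorem continuous_coords_config (M : CM (m + 1)) (τ : Equiv.Perm (Fin (m + 1))) :
    Continuous fun t => M.coords (M.config t τ) := by
  refine continuous_pi fun e => (continuous_homog (weight_ne_zero e)).comp ?_
  have h : ∀ t, block (M.config t τ) (e.1.1.1, e.1.2.1) =
      (Finset.univ.filter fun k => (rk M.rowJumps k, rk M.colJumps (τ k)) =
        (e.1.1.1, e.1.2.1)).val.map fun k =>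
          (pos rowJumps M.rowJumps t k : ℂ) + pos colJumps M.colJumps t (τ k) * Complex.I := by
    intro t
    rw [block, config, Multiset.filter_map, Multiset.map_map, Finset.filter_val]
    refine Multiset.map_congr rfl fun k _ => ?_
    exact Complex.mk_eq_add_mul_I _ _
  simp only [h]
  refine continuous_rootsPoly_coeff _ (fun k => ?_) _
  exact (Complex.continuous_ofReal.comp (continuous_pos _ _ _)).add
    ((Complex.continuous_ofReal.comp (continuous_pos _ _ _)).mul continuous_const)

open Classical in
/-- The coordinates of the configuration described by a weighted chain. -/
noncomputable def chainCoords (M : CM (m + 1)) (t : CM (m + 1) → ℝ) : M.CoeffIndex → ℂ :=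
  M.coords (M.config t (if h : ∃ τ, M.Adapted t τ then h.choose else 1))

/-- The choice of permutation is immaterial on the cone, and by `exists_adapted` the default `1` is
never used there. -/
theorem chainCoords_eq {M : CM (m + 1)} {t : CM (m + 1) → ℝ} (ht : t ∈ chainCone M)
    {τ : Equiv.Perm (Fin (m + 1))} (hτ : M.Adapted t τ) :
    M.chainCoords t = M.coords (M.config t τ) := by
  have h : ∃ τ, M.Adapted t τ := ⟨τ, hτ⟩
  unfold chainCoords
  rw [dif_pos h, ← map_relabel_keyConf, keyConf_eq_of_adapted ht h.choose_spec hτ,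
    map_relabel_keyConf]

theorem Adapted.smul {M : CM (m + 1)} {t : CM (m + 1) → ℝ} {τ : Equiv.Perm (Fin (m + 1))}
    (hτ : M.Adapted t τ) (c : ℝ) : M.Adapted (c • t) τ :=
  ⟨hτ.1, fun N hN => hτ.2 N fun h => hN (by rw [Pi.smul_apply, h, smul_zero])⟩

theorem chainCoords_smul {M : CM (m + 1)} {t : CM (m + 1) → ℝ} (ht : t ∈ chainCone M) {c : ℝ}
    (hc : 0 ≤ c) : M.chainCoords (c • t) = c • M.chainCoords t := by
  obtain ⟨τ, hτ⟩ := exists_adapted ht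
  rw [chainCoords_eq ht hτ, chainCoords_eq (smul_mem_chainCone ht hc) (hτ.smul c), config_smul,
    coords_map_smul (map_fst_config hτ.1 t) hc]

/-- The chains supported above a fixed `N₀ ≤ M` form a closed set on which a single permutation is
adapted, so the coordinates are continuous there; finitely many such sets cover the cone. -/
theorem continuousOn_chainCoords (M : CM (m + 1)) : ContinuousOn M.chainCoords (chainCone M) := by
  rw [continuousOn_iff_continuous_domRestrict]
  let C : Set.Iic M → Set (chainCone M) := fun N₀ => {t | ∀ N, ¬ N₀.1 ≤ N → t.1 N = 0}
  refine (locallyFinite_of_finite C).continuous ?_ ?_ ?_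
  · refine Set.eq_univ_of_forall fun t => ?_
    obtain ⟨N₀, hM, hle, -⟩ := exists_least t.2
    exact Set.mem_iUnion.2 ⟨⟨N₀, hM⟩, fun N hN => by_contra fun h => hN (hle N h)⟩
  · intro N₀
    have : C N₀ = ⋂ N, ⋂ (_ : ¬ N₀.1 ≤ N), {t | t.1 N = 0} := by
      ext t
      simp [C]
    rw [this]
    refine isClosed_iInter fun N => isClosed_iInter fun _ => ?_
    exact isClosed_eq ((continuous_apply N).comp continuous_subtype_val) continuous_const
  · intro N₀
    obtain ⟨τ, hτ⟩ := N₀.1.exists_sorts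
    refine ((continuous_coords_config M τ).comp continuous_subtype_val).continuousOn.congr ?_
    intro t ht
    refine chainCoords_eq t.2 (Adapted.of_least N₀.2 (fun N hN => ?_) hτ)
    by_contra h
    exact hN (ht N h)

theorem chainCoords_bijOn (M : CM (m + 1)) :
    Set.BijOn M.chainCoords (chainCone M) (LinearMap.ker M.moments) := by
  refine ⟨fun t ht => ?_, fun t ht t' ht' h => ?_, fun w hw => ?_⟩
  · obtain ⟨τ, hτ⟩ := exists_adapted ht
    rw [chainCoords_eq ht hτ]
    exact moments_config hτ.1 t
  · obtain ⟨τ, hτ⟩ := exists_adapted ht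
    obtain ⟨τ', hτ'⟩ := exists_adapted ht'
    rw [chainCoords_eq ht hτ, chainCoords_eq ht' hτ'] at h
    have := coords_injOn (map_fst_config hτ.1 t) (map_fst_config hτ'.1 t') h
    rw [← map_relabel_keyConf, ← map_relabel_keyConf] at this
    exact keyConf_injOn ht ht' hτ hτ' (Multiset.map_injective relabel_injective this)
  · obtain ⟨Z, hZ, rfl⟩ := M.exists_coords_eq w
    have hmom : M.moments (M.coords Z) = 0 := hw
    rw [moments_coords hZ, Prod.ext_iff] at hmom
    have hmem : ∀ z ∈ Z, z.1.1 < M.rows ∧ z.1.2 < M.cols := by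
      intro z hz
      have h := Multiset.mem_map_of_mem Prod.fst hz
      rw [hZ] at h
      exact ⟨M.mem_map_fst_pts.1 (Multiset.mem_map_of_mem Prod.fst h),
        M.mem_map_snd_pts.1 (Multiset.mem_map_of_mem Prod.snd h)⟩
    have key := M.exists_keyConf_eq (S := Z.map unlabel) ?_ ?_ ?_
    · obtain ⟨t, ht, τ, hτ, h⟩ := key
      refine ⟨t, ht, ?_⟩
      rw [chainCoords_eq ht hτ, ← map_relabel_keyConf, h, Multiset.map_map]
      exact congrArg _ (Multiset.map_id' Z)
    · rw [Multiset.map_map, ← hZ]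
      rfl
    · intro i
      rw [Multiset.filter_map, Multiset.map_map]
      by_cases hi : i < M.rows
      · exact neg_eq_zero.1 (congrFun hmom.1 ⟨i, hi⟩)
      -- Labels beyond the size of `M` do not occur, so their sums are empty.
      · have : Z.filter ((fun z => (ofLex z.1).1 = i) ∘ unlabel) = 0 :=
          Multiset.filter_eq_nil.2 fun z hz h => hi (lt_of_eq_of_lt (Eq.symm h) (hmem z hz).1)
        rw [this]
        simp
    · intro j
      rw [Multiset.filter_map, Multiset.map_map]
      by_cases hj : j < M.cols
      · exact neg_eq_zero.1 (congrFun hmom.2 ⟨j, hj⟩)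
      · have : Z.filter ((fun z => (ofLex z.2).1 = j) ∘ unlabel) = 0 :=
          Multiset.filter_eq_nil.2 fun z hz h => hj (lt_of_eq_of_lt (Eq.symm h) (hmem z hz).2)
        rw [this]
        simp

/-- The lower interval of a contingency matrix is a closed cell, with boundary the strict lower
interval. -/
theorem exists_homeomorph_closedBall (M : CM (m + 1)) :
    ∃ h : chainWeights (Set.Iic M) ≃ₜ Metric.closedBall (0 : EuclideanSpace ℝ (Fin M.cellDim)) 1,
      ∀ t, 0 < t.1 M ↔ (h t).1 ∈ Metric.ball (0 : EuclideanSpace ℝ (Fin M.cellDim)) 1 := by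
  let E := LinearMap.ker M.moments
  -- The coordinates are known to lie in the kernel only for `t` in the cone; a linear projection
  -- onto the kernel yields a map defined for all `t`.
  obtain ⟨π, hπ⟩ := LinearMap.exists_leftInverse_of_injective E.subtype E.ker_subtype
  have hπ' : ∀ w (hw : w ∈ E), π w = ⟨w, hw⟩ := fun w hw => LinearMap.congr_fun hπ ⟨w, hw⟩
  let e : E ≃L[ℝ] EuclideanSpace ℝ (Fin M.cellDim) := ContinuousLinearEquiv.ofFinrankEq (by
    rw [finrank_euclideanSpace_fin]
    exact M.finrank_ker_moments)
  have hbij := M.chainCoords_bijOn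
  refine PosetNerve.exists_homeomorph_closedBall M (fun t => e (π (M.chainCoords t))) ?_ ?_ ?_
  · exact e.continuous.comp_continuousOn
      (π.continuous_of_finiteDimensional.comp_continuousOn (continuousOn_chainCoords M))
  · refine ⟨fun _ _ => Set.mem_univ _, fun t ht t' ht' h => ?_, fun v _ => ?_⟩
    · have h' := e.injective h
      rw [hπ' _ (hbij.mapsTo ht), hπ' _ (hbij.mapsTo ht')] at h'
      exact hbij.injOn ht ht' (congrArg Subtype.val h')
    · obtain ⟨t, ht, h⟩ := hbij.surjOn (e.symm v).2
      refine ⟨t, ht, ?_⟩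
      change e (π (M.chainCoords t)) = v
      rw [h, hπ' _ (e.symm v).2]
      exact e.apply_symm_apply v
  · intro t ht c hc
    rw [chainCoords_smul ht hc, map_smul, map_smul]

end CM

/-! ### Monotonicity of the dimension, boundary spheres and the theorem. -/

namespace CM

/-- Contractions lower the size, and `size_le` ensures that the subtraction in `cellDim` is not
truncated. -/
theorem strictMono_cellDim (n : ℕ) : StrictMono (cellDim (n := n)) := by
  intro M N h
  have h1 := (size_lt_or_eq h.le).resolve_right h.ne
  have h2 := M.mat.size_le
  unfold cellDim
  omega

end CM

namespace PosetNerve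

variable {T : Type} [Fintype T] [PartialOrder T]

theorem mem_chainWeights_Iio {M : T} {t : T → ℝ} (ht : t ∈ chainWeights (Set.Iic M)) :
    t ∈ chainWeights (Set.Iio M) ↔ ¬ 0 < t M := by
  constructor
  · intro h hM
    exact lt_irrefl M (h.2.2.2 hM.ne')
  · intro h
    refine ⟨ht.1, ht.2.1, ht.2.2.1, fun N hN => lt_of_le_of_ne (ht.2.2.2 hN) ?_⟩
    rintro rfl
    exact h (lt_of_le_of_ne (ht.1 N) (Ne.symm hN))

/-- If the nerve of the elements `≤ M` is a closed ball with interior the points of positive weight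
at `M`, the nerve of the elements below `M` is a sphere. -/
theorem nonempty_homeomorph_sphere {M : T} {d : ℕ}
    (h : chainWeights (Set.Iic M) ≃ₜ Metric.closedBall (0 : EuclideanSpace ℝ (Fin d)) 1)
    (hh : ∀ t, 0 < t.1 M ↔ (h t).1 ∈ Metric.ball (0 : EuclideanSpace ℝ (Fin d)) 1) :
    Nonempty (PosetNerve (Set.Iio M) ≃ₜ Metric.sphere (0 : EuclideanSpace ℝ (Fin d)) 1) := by
  refine ⟨(homeomorphChainWeights _).trans (h.restrictSubsets ?_ Metric.sphere_subset_closedBall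
    fun t => ?_)⟩
  · exact fun t ht => ⟨ht.1, ht.2.1, ht.2.2.1, ht.2.2.2.trans Set.Iio_subset_Iic_self⟩
  · rw [mem_chainWeights_Iio t.2, hh, Metric.mem_ball, Metric.mem_sphere]
    exact ⟨fun h' => le_antisymm (h t).2 (not_lt.1 h'), fun h' => not_lt.2 h'.ge⟩

end PosetNerve

theorem theorem3p2 (n : ℕ) (hn : 0 < n) :
    -- `F(M)` is a closed cell of dimension `2n - (p + q)`, `F'(M)` is a sphere of dimension one less
    (∀ M : CM n, IsClosedCell M.cellDim M.F ∧
      Nonempty (M.F' ≃ₜ Metric.sphere (0 : EuclideanSpace ℝ (Fin M.cellDim)) 1)) ∧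
    -- `F(M)` and `F'(M)` are closed subspaces of the stochastihedron
    (∀ M : CM n, Topology.IsClosedEmbedding (PosetNerve.incl (Set.Iic M)) ∧
      Topology.IsClosedEmbedding (PosetNerve.incl (Set.Iio M))) ∧
    -- the `F°(M)` are the cells of a regular cell decomposition, with cell poset `CM n`
    ∃ D : CellDecomposition (Stochastihedron n), D.IsRegular ∧
      (∀ M : CM n, M.openFace ∈ D.cells M.cellDim ∧ closure M.openFace = M.closedFace) ∧
      ∃ e : CM n ≃o D.Cell, ∀ M : CM n, (e M).1 = M.openFace := by
  -- With `n = m + 1` points there are `m` places between neighbours where a jump can occur.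
  obtain ⟨m, rfl⟩ := Nat.exists_eq_succ_of_ne_zero hn.ne'
  refine ⟨fun M => ?_, fun M => ⟨PosetNerve.isClosedEmbedding_incl _,
    PosetNerve.isClosedEmbedding_incl _⟩, ?_⟩
  · obtain ⟨h, hh⟩ := M.exists_homeomorph_closedBall
    exact ⟨⟨(PosetNerve.homeomorphChainWeights _).trans h⟩,
      PosetNerve.nonempty_homeomorph_sphere h hh⟩
  · exact PosetNerve.exists_cellDecomposition (CM.strictMono_cellDim _)
      fun M => M.exists_homeomorph_closedBall
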